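/- **Setting.** For each $k\ge 1$ let $X=X_k$ be a deterministic $n\times p$ real matrix ($n=n(k)$, $p=p(k)$) with rows $x_1^T,\dots,x_n^T$, having exactly $q=q(k)\ge 1$ distinct rows $\tilde x_1^T,\dots,\tilde x_q^T$, each of which is repeated at least $r=r(k)\ge 1$ times, and suppose $n(k),p(k)\to\infty$ as $k\to\infty$. Let $G:\mathbb R\to(0,1)$ be a function not depending on $k$, let $\beta_*=\beta_{*,k}\in\mathbb R^{p}$, and let the binary responses $y_1,\dots,y_n$ be independent with $y_i\sim\mathrm{Bernoulli}(G(x_i^T\beta_*))$; $\tilde{\mathbb P}$ is the probability with respect to $y=(y_1,\dots,y_n)$. Let $v=v_k\in\mathbb R^p$, let $Q=Q_k$ be a $p\times p$ matrix that is either symmetric positive definite or zero, and put $\Sigma=X^TX+Q$. The probit posterior $\Pi$ is the probability measure on $\mathbb R^p$ with density proportional to $$\prod_{i=1}^n\Phi(x_i^T\beta)^{y_i}\bigl(1-\Phi(x_i^T\beta)\bigr)^{1-y_i}\exp\Bigl[-\tfrac12(\beta-v)^TQ(\beta-v)\Bigr],$$ where $\Phi$ is the standard normal distribution function; the posterior is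 called proper if this function has finite integral. The Albert and Chib Markov chain with transition function $K$ moves from $\beta$ to $\tilde\beta$ as follows: draw independently $Z_i$, $i=1,\dots,n$, from $\mathrm N(x_i^T\beta,1)$ truncated to $(0,\infty)$ if $y_i=1$ and to $(-\infty,0)$ if $y_i=0$; then draw $\tilde\beta\sim\mathrm N\bigl(\Sigma^{-1}(X^TZ+Qv),\Sigma^{-1}\bigr)$. Let $\psi(\beta,\beta')=\bigl((\beta-\beta')^T\Sigma(\beta-\beta')\bigr)^{1/2}$, and let $W_\psi$ be the Wasserstein distance between probability measures induced by $\psi$, that is, the infimum of $\int\psi\,d\upsilon$ over all couplings $\upsilon$. For a distance $D$ between probability measures, the convergence rate is the infimum in $[0,1]$ of the $\rho\in[0,1]$ for which there is a function $M:\mathbb R^p\to[0,\infty)$ with $D(K^m_\beta,\Pi)\le M(\beta)\rho^m$ for all $m\ge0$ and all $\beta\in\mathbb R^p$. It is denoted by $\rho_*(\psi)$ for $D=W_\psi$, and by $\rho_*^{\mathrm{TV}}$ for the total variation distance $D(\mu,\nu)=\sup_A|\mu(A)-\nu(A)|$. **Proposition.** Assume that 1. for every $k$, $\Sigma$ is non-singular;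 2. $\sigma\sqrt{2\log p}\to0$ as $k\to\infty$, where $\sigma=\lambda_{\max}^{1/2}\Bigl[\sum_{i=1}^n\bigl(\Sigma^{-1/2}x_ix_i^T\Sigma^{-1/2}\bigr)^2\Bigr]$ and $\lambda_{\max}$ denotes the largest eigenvalue; 3. $(\log q)/r\to0$ as $k\to\infty$; 4. there is a constant $\ell$, independent of $k$, such that $\max_{1\le i\le q}|\tilde x_i^T\beta_*|<\ell$ for every $k$, and $\inf_{|\mu|<\ell}\min\{G(\mu),1-G(\mu)\}>0$. Then the probability that the posterior is proper tends to $1$, and there is a constant $\rho<1$, independent of $k$, such that for every $\epsilon>0$ $$\lim_{k\to\infty}\tilde{\mathbb P}\bigl(\rho_*(\psi)>\rho+\epsilon\bigr)=0\qquad\text{and}\qquad\lim_{k\to\infty}\tilde{\mathbb P}\bigl(\rho_*^{\mathrm{TV}}>\rho+\epsilon\bigr)=0 .$$ (The rates are defined when the posterior is proper; whether the exceptional event on which it is improper is counted is immaterial, since its probability tends to $0$.) -/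

import Mathlib

open MeasureTheory ProbabilityTheory Filter Topology
open scoped Matrix MatrixOrder ENNReal NNReal

noncomputable section

namespace ProbitAC

/-! ### Distances between measures and convergence rates of Markov chains -/

section General

variable {α : Type*} [MeasurableSpace α]

/-- `γ` is a coupling of `μ` and `ν`: a probability measure on the product space whose marginals
are `μ` and `ν`. -/
def IsCoupling (γ : Measure (α × α)) (μ ν : Measure α) : Prop :=
  IsProbabilityMeasure γ ∧ γ.fst = μ ∧ γ.snd = ν

/-- The Wasserstein distance induced by `ψ`: the infimum of `∫ ψ dγ` over all couplings `γ`. -/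
def wasserstein (ψ : α → α → ℝ) (μ ν : Measure α) : ℝ≥0∞ :=
  ⨅ (γ : Measure (α × α)) (_ : IsCoupling γ μ ν), ∫⁻ z, ENNReal.ofReal (ψ z.1 z.2) ∂γ

/-- The total variation distance: the supremum of the discrepancy over measurable sets. -/
def tvDist (μ ν : Measure α) : ℝ≥0∞ :=
  ⨆ (A : Set α) (_ : MeasurableSet A), ENNReal.ofReal |μ.real A - ν.real A|

/-- `D(K_x^m, π) ≤ M(x) ρ^m` for all `m ≥ 0` and all `x`, for some finite function `M ≥ 0`. -/
def GeometricBound (D : Measure α → Measure α → ℝ≥0∞) (K : Kernel α α) (π : Measure α)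
    (ρ : ℝ) : Prop :=
  ∃ M : α → ℝ≥0, ∀ (m : ℕ) (x : α), D ((K ^ m) x) π ≤ M x * ENNReal.ofReal ρ ^ m

/-- The convergence rate in `[0, 1]`: the infimum, taken in `[0, 1]`, of the `ρ ∈ [0, 1]` for which
a geometric bound holds. (The infimum in `[0, 1]` of the empty set is `1`; this is why `ρ = 1` is
always admitted.) -/
def convergenceRate (D : Measure α → Measure α → ℝ≥0∞) (K : Kernel α α) (π : Measure α) : ℝ :=
  sInf {ρ : ℝ | ρ ∈ Set.Icc (0 : ℝ) 1 ∧ (ρ = 1 ∨ GeometricBound D K π ρ)}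

end General

/-! ### Bayesian probit regression -/

section Probit

variable {n p : ℕ}

/-- The linear predictor `x_iᵀ β`, where `x_iᵀ` is the `i`-th row of `X`. -/
def linPred (X : Matrix (Fin n) (Fin p) ℝ) (β : EuclideanSpace ℝ (Fin p)) (i : Fin n) : ℝ :=
  (X *ᵥ β.ofLp) i

/-- `Σ = Xᵀ X + Q`. -/
def precision (X : Matrix (Fin n) (Fin p) ℝ) (Q : Matrix (Fin p) (Fin p) ℝ) :
    Matrix (Fin p) (Fin p) ℝ :=
  Xᵀ * X + Q

/-- The standard normal cumulative distribution function. -/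
def stdNormalCDF (t : ℝ) : ℝ := cdf (gaussianReal 0 1) t

/-- The unnormalized posterior density of the regression coefficient. -/
def posteriorWeight (X : Matrix (Fin n) (Fin p) ℝ) (Q : Matrix (Fin p) (Fin p) ℝ)
    (v : EuclideanSpace ℝ (Fin p)) (y : Fin n → Bool) (β : EuclideanSpace ℝ (Fin p)) : ℝ :=
  (∏ i, if y i then stdNormalCDF (linPred X β i) else 1 - stdNormalCDF (linPred X β i)) *
    Real.exp (-(1 / 2) * ((β - v).ofLp ⬝ᵥ (Q *ᵥ (β - v).ofLp)))

/-- The total mass of the unnormalized posterior. -/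
def posteriorMass (X : Matrix (Fin n) (Fin p) ℝ) (Q : Matrix (Fin p) (Fin p) ℝ)
    (v : EuclideanSpace ℝ (Fin p)) (y : Fin n → Bool) : ℝ≥0∞ :=
  ∫⁻ β, ENNReal.ofReal (posteriorWeight X Q v y β)

/-- The posterior is proper: the (everywhere positive) unnormalized posterior density has finite
total mass. -/
def PosteriorProper (X : Matrix (Fin n) (Fin p) ℝ) (Q : Matrix (Fin p) (Fin p) ℝ)
    (v : EuclideanSpace ℝ (Fin p)) (y : Fin n → Bool) : Prop :=
  posteriorMass X Q v y < ∞

/-- The posterior distribution (meaningful when the posterior is proper). -/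
def posterior (X : Matrix (Fin n) (Fin p) ℝ) (Q : Matrix (Fin p) (Fin p) ℝ)
    (v : EuclideanSpace ℝ (Fin p)) (y : Fin n → Bool) : Measure (EuclideanSpace ℝ (Fin p)) :=
  (posteriorMass X Q v y)⁻¹ •
    volume.withDensity fun β => ENNReal.ofReal (posteriorWeight X Q v y β)

/-! ### The Albert and Chib Markov chain -/

/-- The half-line to which a latent variable is truncated. -/
def halfLine (a : Bool) : Set ℝ := if a then Set.Ioi 0 else Set.Iio 0

/-- `TN(μ, 1; a)`: the normal distribution `N(μ, 1)` truncated to `(0, ∞)` if `a = 1` and to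
`(-∞, 0)` if `a = 0`. -/
def truncNormal (μ : ℝ) (a : Bool) : Measure ℝ :=
  ProbabilityTheory.cond (gaussianReal μ 1) (halfLine a)

lemma measurableSet_halfLine (a : Bool) : MeasurableSet (halfLine a) := by
  cases a <;> simp [halfLine, measurableSet_Ioi, measurableSet_Iio]

lemma gaussianReal_halfLine_ne_zero (μ : ℝ) (a : Bool) : gaussianReal μ 1 (halfLine a) ≠ 0 := by
  intro h
  have h2 := gaussianReal_absolutelyContinuous' μ (one_ne_zero : (1 : ℝ≥0) ≠ 0) h
  cases a <;> simp [halfLine] at h2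

instance (μ : ℝ) (a : Bool) : IsProbabilityMeasure (truncNormal μ a) :=
  cond_isProbabilityMeasure (gaussianReal_halfLine_ne_zero μ a)

lemma measurable_truncNormal (a : Bool) : Measurable fun μ => truncNormal μ a := by
  have hg : Measurable fun μ : ℝ => gaussianReal μ 1 :=
    measurable_gaussianReal.comp (measurable_id.prodMk measurable_const)
  refine Measure.measurable_of_measurable_coe _ fun s hs => ?_
  simp only [truncNormal, cond_apply (measurableSet_halfLine a)]
  exact ((Measure.measurable_coe (measurableSet_halfLine a)).comp hg).inv.mul
    ((Measure.measurable_coe ((measurableSet_halfLine a).inter hs)).comp hg)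

/-- First step of the algorithm: given `β`, draw `Z_i ~ TN(x_iᵀ β, 1; y_i)` independently. -/
def latentKernel (X : Matrix (Fin n) (Fin p) ℝ) (y : Fin n → Bool) :
    Kernel (EuclideanSpace ℝ (Fin p)) (Fin n → ℝ) where
  toFun β := Measure.pi fun i => truncNormal (linPred X β i) (y i)
  measurable' := by
    refine Measurable.measure_of_isPiSystem_of_isProbabilityMeasure generateFrom_pi.symm
      isPiSystem_pi ?_
    rintro _ ⟨s, hs, rfl⟩
    simp only [Measure.pi_pi]
    refine Finset.measurable_prod _ fun i _ => ?_
    have hl : Measurable fun β : EuclideanSpace ℝ (Fin p) => linPred X β i := by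
      unfold linPred Matrix.mulVec dotProduct
      fun_prop
    have hsi : MeasurableSet (s i) := hs i (Set.mem_univ i)
    exact (Measure.measurable_coe hsi).comp
      ((measurable_truncNormal (y i)).comp hl)

/-- The mean `Σ⁻¹ (Xᵀ z + Q v)` of the Gaussian full conditional of the coefficient. -/
def updateMean (X : Matrix (Fin n) (Fin p) ℝ) (Q : Matrix (Fin p) (Fin p) ℝ)
    (v : EuclideanSpace ℝ (Fin p)) (z : Fin n → ℝ) : EuclideanSpace ℝ (Fin p) :=
  WithLp.toLp 2 ((precision X Q)⁻¹ *ᵥ (Xᵀ *ᵥ z + Q *ᵥ v.ofLp))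

/-- Second step of the algorithm: given `z`, draw from `N(Σ⁻¹ (Xᵀ z + Q v), Σ⁻¹)`. -/
def updateKernel (X : Matrix (Fin n) (Fin p) ℝ) (Q : Matrix (Fin p) (Fin p) ℝ)
    (v : EuclideanSpace ℝ (Fin p)) : Kernel (Fin n → ℝ) (EuclideanSpace ℝ (Fin p)) where
  toFun z := multivariateGaussian (updateMean X Q v z) (precision X Q)⁻¹
  measurable' := by
    have hm : Measurable (updateMean X Q v) := by
      have : Continuous (updateMean X Q v) := by
        unfold updateMean
        fun_prop
      exact this.measurable
    refine Measure.measurable_of_measurable_coe _ fun s hs => ?_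
    have hf : Measurable fun w : (Fin n → ℝ) × EuclideanSpace ℝ (Fin p) =>
        updateMean X Q v w.1 +
          Matrix.toEuclideanCLM (𝕜 := ℝ) (CFC.sqrt (precision X Q)⁻¹) w.2 := by
      fun_prop
    have h := measurable_measure_prodMk_left
      (ν := stdGaussian (EuclideanSpace ℝ (Fin p))) (hf hs)
    convert h using 2 with z
    rw [multivariateGaussian, Measure.map_apply (by fun_prop) hs]
    rfl

/-- The Markov transition function of the Albert and Chib chain. -/
def acKernel (X : Matrix (Fin n) (Fin p) ℝ) (Q : Matrix (Fin p) (Fin p) ℝ)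
    (v : EuclideanSpace ℝ (Fin p)) (y : Fin n → Bool) :
    Kernel (EuclideanSpace ℝ (Fin p)) (EuclideanSpace ℝ (Fin p)) :=
  updateKernel X Q v ∘ₖ latentKernel X y

/-- The distance `ψ(β, β') = ((β - β')ᵀ Σ (β - β'))^{1/2}`. -/
def psi (X : Matrix (Fin n) (Fin p) ℝ) (Q : Matrix (Fin p) (Fin p) ℝ)
    (β β' : EuclideanSpace ℝ (Fin p)) : ℝ :=
  √((β - β').ofLp ⬝ᵥ (precision X Q *ᵥ (β - β').ofLp))

/-- `ρ_*(ψ)`: the convergence rate of the Albert and Chib chain in the Wasserstein distance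
induced by `ψ`. -/
def rateW (X : Matrix (Fin n) (Fin p) ℝ) (Q : Matrix (Fin p) (Fin p) ℝ)
    (v : EuclideanSpace ℝ (Fin p)) (y : Fin n → Bool) : ℝ :=
  convergenceRate (wasserstein (psi X Q)) (acKernel X Q v y) (posterior X Q v y)

/-- The convergence rate of the Albert and Chib chain in total variation. -/
def rateTV (X : Matrix (Fin n) (Fin p) ℝ) (Q : Matrix (Fin p) (Fin p) ℝ)
    (v : EuclideanSpace ℝ (Fin p)) (y : Fin n → Bool) : ℝ :=
  convergenceRate tvDist (acKernel X Q v y) (posterior X Q v y)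

/-! ### The design -/

/-- The largest eigenvalue of a real symmetric matrix. -/
def lambdaMax (A : Matrix (Fin p) (Fin p) ℝ) : ℝ := sSup (spectrum ℝ A)

/-- `σ = λ_max^{1/2} [∑_i (Σ^{-1/2} x_i x_iᵀ Σ^{-1/2})²]`. -/
def sigmaErr (X : Matrix (Fin n) (Fin p) ℝ) (Q : Matrix (Fin p) (Fin p) ℝ) : ℝ :=
  √(lambdaMax (∑ i, (CFC.sqrt (precision X Q)⁻¹ * Matrix.vecMulVec (X i) (X i) *
    CFC.sqrt (precision X Q)⁻¹) ^ 2))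

/-- `X` has exactly `q` distinct rows, and each distinct row is repeated at least `r` times, for
positive integers `q` and `r`. -/
def IsRepeatedDesign (X : Matrix (Fin n) (Fin p) ℝ) (q r : ℕ) : Prop :=
  0 < q ∧ 0 < r ∧ (Set.range fun i => X i).ncard = q ∧ ∀ i, r ≤ {j | X j = X i}.ncard

end Probit

end ProbitAC

end

/-! One step of the chain is a random map: each latent variable is a quantile transform of a uniform
variable, and Gaussian noise is added to the updated mean. Two copies driven by the same noise
contract in mean square, which bounds both convergence rates.

Write w_i = Σ^{-1/2} x_i and ω = Σ^{1/2}(β - β'). After one synchronous step the Gaussian noise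
cancels, and ψ is the norm of ∑ D_i w_i, where the D_i are the differences of the latent variables.
The D_i are independent, and |D_i| ≤ |⟨w_i, ω⟩| because Φ is log-concave (`posTruncQuantile_sub`).
The second moment of the norm splits into a squared mean and a variance.

Variance: it is at most ∑ ⟨w_i, ω⟩² ‖w_i‖² ≤ σ² ‖ω‖² (`sum_inner_sq_mul_norm_sq_le`), and σ → 0.

Mean: E D_i = s_i ⟨w_i, ω⟩ with a slope s_i in [0, 1], so the mean is Aω with A = ∑ s_i w_i w_iᵀ,
while ∑ w_i w_iᵀ ≤ I. A single slope may be close to 1, but at a common row the slopes for the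
responses 1 and 0 add up to at most 7/4 (`truncSlope_add_le`): the slope is an average of variances
of truncated normals, and such a variance is at most 3/4 when the location lies on the wrong side of
the truncation point. If each response makes up a fraction at least η of every group of equal rows,
then A ≤ (1 - η/4) I (`sum_response_le`). Hence the mean-square factor is (1 - η/4)² + σ²
(`lintegral_psi_acMap_sq_le`).

Hoeffding's inequality and a union bound over the distinct rows give this balance with probability
tending to 1 (`measure_not_isBalanced_le`). Balance also makes the posterior proper with exponential
tails (`exists_posteriorWeight_le`), so ψ² is integrable under it and the coupling can be started
from stationarity. Total variation follows from the Wasserstein bound because the transition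
probabilities are Lipschitz for ψ (`exists_acKernel_lipschitz`). -/

noncomputable section

namespace ProbitAC

/-! ### Synchronous couplings of a random map and geometric convergence -/

section RandomMap

variable {α Ξ : Type*} [MeasurableSpace α] [MeasurableSpace Ξ]

lemma convergenceRate_le {D : Measure α → Measure α → ℝ≥0∞} {K : Kernel α α} {π : Measure α}
    {ρ : ℝ} (h0 : 0 ≤ ρ) (h1 : ρ ≤ 1) (h : GeometricBound D K π ρ) :
    convergenceRate D K π ≤ ρ :=
  csInf_le ⟨0, fun _ hx => hx.1.1⟩ ⟨⟨h0, h1⟩, Or.inr h⟩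

lemma kernel_pow_succ_apply (K : Kernel α α) (m : ℕ) (x : α) :
    (K ^ (m + 1)) x = ((K ^ m) x).bind K := by
  ext s hs
  rw [Kernel.pow_succ_apply_eq_lintegral K m x hs, Measure.bind_apply hs K.measurable.aemeasurable]

/-- One synchronous step of a random map applied to a coupling. -/
def coupledStep (f : α → Ξ → α) (ν : Measure Ξ) (γ : Measure (α × α)) : Measure (α × α) :=
  (γ.prod ν).map fun w => (f w.1.1 w.2, f w.1.2 w.2)

lemma map_prod_randomMap {K : Kernel α α} {ν : Measure Ξ} [IsProbabilityMeasure ν]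
    {f : α → Ξ → α} (hf : Measurable (Function.uncurry f)) (hK : ∀ x, K x = ν.map (f x))
    (μ : Measure α) : (μ.prod ν).map (Function.uncurry f) = μ.bind K := by
  ext s hs
  rw [Measure.map_apply hf hs, Measure.prod_apply (hf hs),
    Measure.bind_apply hs K.measurable.aemeasurable]
  refine lintegral_congr fun x => ?_
  have hfx : Measurable (f x) := hf.comp measurable_prodMk_left
  rw [hK, Measure.map_apply hfx hs]
  rfl

/-- The noise is shared by the two coordinates but independent of the current pair, so each
coordinate by itself makes an ordinary transition. -/
lemma isCoupling_coupledStep {K : Kernel α α} {ν : Measure Ξ} [IsProbabilityMeasure ν]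
    {f : α → Ξ → α} (hf : Measurable (Function.uncurry f)) (hK : ∀ x, K x = ν.map (f x))
    {γ : Measure (α × α)} {μ₁ μ₂ : Measure α} (h : IsCoupling γ μ₁ μ₂) :
    IsCoupling (coupledStep f ν γ) (μ₁.bind K) (μ₂.bind K) := by
  obtain ⟨hp, rfl, rfl⟩ := h
  have h1 : Measurable fun w : (α × α) × Ξ => f w.1.1 w.2 :=
    hf.comp (measurable_fst.fst.prodMk measurable_snd)
  have h2 : Measurable fun w : (α × α) × Ξ => f w.1.2 w.2 :=
    hf.comp (measurable_fst.snd.prodMk measurable_snd)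
  refine ⟨Measure.isProbabilityMeasure_map (h1.prodMk h2).aemeasurable, ?_, ?_⟩
  · rw [coupledStep, Measure.fst_map_prodMk h2, ← map_prod_randomMap hf hK, Measure.fst,
      ← Measure.map_id (μ := ν), Measure.map_prod_map _ _ measurable_fst measurable_id,
      Measure.map_map hf (by fun_prop), Measure.map_id]
    rfl
  · rw [coupledStep, Measure.snd_map_prodMk h1, ← map_prod_randomMap hf hK, Measure.snd,
      ← Measure.map_id (μ := ν), Measure.map_prod_map _ _ measurable_snd measurable_id,
      Measure.map_map hf (by fun_prop), Measure.map_id]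
    rfl

/-- Iterating a random map which contracts in mean square couples the chain started at `x` with
the invariant distribution. -/
lemma exists_coupling_pow {K : Kernel α α} {ν : Measure Ξ} [IsProbabilityMeasure ν]
    {f : α → Ξ → α} (hf : Measurable (Function.uncurry f)) (hK : ∀ x, K x = ν.map (f x))
    {π : Measure α} [IsProbabilityMeasure π] (hπ : π.bind K = π)
    {d : α → α → ℝ≥0∞} (hd : Measurable (Function.uncurry d)) {c : ℝ≥0∞}
    (hc : ∀ b b', ∫⁻ ξ, d (f b ξ) (f b' ξ) ^ 2 ∂ν ≤ c * d b b' ^ 2) (x : α) (m : ℕ) :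
    ∃ γ, IsCoupling γ ((K ^ m) x) π ∧
      ∫⁻ z, d z.1 z.2 ^ 2 ∂γ ≤ c ^ m * ∫⁻ b, d x b ^ 2 ∂π := by
  have hd2 : Measurable fun z : α × α => d z.1 z.2 ^ 2 := hd.pow_const 2
  induction m with
  | zero =>
    refine ⟨(Measure.dirac x).prod π, ⟨inferInstance, ?_, ?_⟩, ?_⟩
    · rw [Measure.fst_prod, pow_zero]; rfl
    · rw [Measure.snd_prod]
    · rw [lintegral_prod _ hd2.aemeasurable, pow_zero, one_mul]
      rw [lintegral_dirac' _ (Measurable.lintegral_prod_right' hd2)]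
  | succ m ih =>
    obtain ⟨γ, hγ, hle⟩ := ih
    have := hγ.1
    refine ⟨coupledStep f ν γ, ?_, ?_⟩
    · have := isCoupling_coupledStep hf hK hγ
      rw [hπ] at this
      rwa [kernel_pow_succ_apply]
    · have hm : Measurable fun w : (α × α) × Ξ => (f w.1.1 w.2, f w.1.2 w.2) :=
        (hf.comp (measurable_fst.fst.prodMk measurable_snd)).prodMk
          (hf.comp (measurable_fst.snd.prodMk measurable_snd))
      rw [coupledStep, lintegral_map hd2 hm]
      have h2 : Measurable fun w : (α × α) × Ξ => d (f w.1.1 w.2) (f w.1.2 w.2) ^ 2 := hd2.comp hm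
      rw [lintegral_prod _ h2.aemeasurable]
      calc ∫⁻ z, ∫⁻ ξ, d (f z.1 ξ) (f z.2 ξ) ^ 2 ∂ν ∂γ
          ≤ ∫⁻ z, c * d z.1 z.2 ^ 2 ∂γ := lintegral_mono fun z => hc _ _
        _ = c * ∫⁻ z, d z.1 z.2 ^ 2 ∂γ := lintegral_const_mul _ hd2
        _ ≤ c * (c ^ m * ∫⁻ b, d x b ^ 2 ∂π) := by gcongr
        _ = _ := by rw [pow_succ', mul_assoc]

lemma lintegral_sq_le_lintegral_sq {μ : Measure α} [IsProbabilityMeasure μ] {g : α → ℝ≥0∞}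
    (hg : Measurable g) : (∫⁻ x, g x ∂μ) ^ 2 ≤ ∫⁻ x, g x ^ 2 ∂μ := by
  have h := ENNReal.lintegral_mul_le_Lp_mul_Lq μ Real.HolderConjugate.two_two hg.aemeasurable
    (aemeasurable_const (b := (1 : ℝ≥0∞)))
  simp only [Pi.mul_apply, mul_one, ENNReal.one_rpow, lintegral_const, measure_univ] at h
  calc (∫⁻ x, g x ∂μ) ^ 2 ≤ ((∫⁻ x, g x ^ (2 : ℝ) ∂μ) ^ (1 / 2 : ℝ)) ^ 2 := by gcongr
    _ = ∫⁻ x, g x ^ 2 ∂μ := by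
      rw [← ENNReal.rpow_natCast, ← ENNReal.rpow_mul]
      norm_num

/-- Under a mean-square contraction the expected distance along the coupling decays
geometrically. -/
lemma exists_coupling_lintegral_le {K : Kernel α α} {ν : Measure Ξ} [IsProbabilityMeasure ν]
    {f : α → Ξ → α} (hf : Measurable (Function.uncurry f)) (hK : ∀ x, K x = ν.map (f x))
    {π : Measure α} [IsProbabilityMeasure π] (hπ : π.bind K = π)
    {d : α → α → ℝ≥0∞} (hd : Measurable (Function.uncurry d)) {ρ : ℝ≥0∞}
    (hc : ∀ b b', ∫⁻ ξ, d (f b ξ) (f b' ξ) ^ 2 ∂ν ≤ ρ ^ 2 * d b b' ^ 2)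
    (hfin : ∀ x, ∫⁻ b, d x b ^ 2 ∂π ≠ ∞) :
    ∃ M : α → ℝ≥0, ∀ (m : ℕ) (x : α), ∃ γ, IsCoupling γ ((K ^ m) x) π ∧
      ∫⁻ z, d z.1 z.2 ∂γ ≤ M x * ρ ^ m := by
  -- With I the initial mean square, I ≤ (1 + I)², so 1 + I can stand in for the square root of I.
  refine ⟨fun x => (1 + ∫⁻ b, d x b ^ 2 ∂π).toNNReal, fun m x => ?_⟩
  obtain ⟨γ, hγ, hle⟩ := exists_coupling_pow hf hK hπ hd hc x m
  have := hγ.1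
  refine ⟨γ, hγ, ?_⟩
  rw [ENNReal.coe_toNNReal (by simpa using hfin x)]
  refine (ENNReal.pow_le_pow_left_iff (two_ne_zero)).1 ?_
  calc (∫⁻ z, d z.1 z.2 ∂γ) ^ 2 ≤ ∫⁻ z, d z.1 z.2 ^ 2 ∂γ := lintegral_sq_le_lintegral_sq hd
    _ ≤ (ρ ^ 2) ^ m * ∫⁻ b, d x b ^ 2 ∂π := hle
    _ ≤ (ρ ^ 2) ^ m * (1 + ∫⁻ b, d x b ^ 2 ∂π) ^ 2 := by
      gcongr
      calc ∫⁻ b, d x b ^ 2 ∂π ≤ 1 + ∫⁻ b, d x b ^ 2 ∂π := le_add_self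
        _ = (1 + ∫⁻ b, d x b ^ 2 ∂π) ^ 1 := (pow_one _).symm
        _ ≤ _ := pow_le_pow_right₀ le_self_add one_le_two
    _ = _ := by rw [mul_pow, mul_comm, ← pow_mul, ← pow_mul, mul_comm 2]

variable {K : Kernel α α} {ν : Measure Ξ} [IsProbabilityMeasure ν] {f : α → Ξ → α}
  {π : Measure α} [IsProbabilityMeasure π] {ψ : α → α → ℝ} {ρ : ℝ}

lemma geometricBound_wasserstein (hf : Measurable (Function.uncurry f))
    (hK : ∀ x, K x = ν.map (f x)) (hπ : π.bind K = π) (hψ : Measurable (Function.uncurry ψ))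
    (hc : ∀ b b', ∫⁻ ξ, ENNReal.ofReal (ψ (f b ξ) (f b' ξ)) ^ 2 ∂ν ≤
      ENNReal.ofReal ρ ^ 2 * ENNReal.ofReal (ψ b b') ^ 2)
    (hfin : ∀ x, ∫⁻ b, ENNReal.ofReal (ψ x b) ^ 2 ∂π ≠ ∞) :
    GeometricBound (wasserstein ψ) K π ρ := by
  obtain ⟨M, hM⟩ := exists_coupling_lintegral_le hf hK hπ
    (d := fun b b' => ENNReal.ofReal (ψ b b')) hψ.ennreal_ofReal hc hfin
  refine ⟨M, fun m x => ?_⟩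
  obtain ⟨γ, hγ, hle⟩ := hM m x
  exact (iInf₂_le γ hγ).trans hle

lemma tvDist_le_one (μ₁ μ₂ : Measure α) [IsProbabilityMeasure μ₁] [IsProbabilityMeasure μ₂] :
    tvDist μ₁ μ₂ ≤ 1 := by
  refine iSup₂_le fun A _ => ?_
  rw [← ENNReal.ofReal_one]
  refine ENNReal.ofReal_le_ofReal (abs_le.2 ⟨?_, ?_⟩) <;>
  linarith [measureReal_nonneg (μ := μ₁) (s := A), measureReal_nonneg (μ := μ₂) (s := A),
    measureReal_le_one (μ := μ₁) (s := A), measureReal_le_one (μ := μ₂) (s := A)]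

/-- Smoothing by one transition: the discrepancy on A after the step is the integral of K(b, A) -
K(b', A) under any coupling, so a small mean of ψ becomes a small total variation distance. -/
lemma tvDist_bind_le [IsMarkovKernel K] {L : ℝ≥0} {γ : Measure (α × α)} {μ₁ μ₂ : Measure α}
    (hγ : IsCoupling γ μ₁ μ₂) (hψ : Measurable (Function.uncurry ψ))
    (hL : ∀ A, MeasurableSet A → ∀ b b', |(K b).real A - (K b').real A| ≤ L * ψ b b') :
    tvDist (μ₁.bind K) (μ₂.bind K) ≤ L * ∫⁻ z, ENNReal.ofReal (ψ z.1 z.2) ∂γ := by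
  obtain ⟨hp, rfl, rfl⟩ := hγ
  refine iSup₂_le fun A hA => ?_
  have hKA : Measurable fun b => (K b).real A :=
    ((Measure.measurable_coe hA).comp K.measurable).ennreal_toReal
  have hb (μ : Measure α) : (μ.bind K).real A = ∫ b, (K b).real A ∂μ := by
    rw [Measure.real, Measure.bind_apply hA K.measurable.aemeasurable]
    exact (integral_toReal ((Measure.measurable_coe hA).comp K.measurable).aemeasurable
      (ae_of_all _ fun b => measure_lt_top _ _)).symm
  have hint {Y : α × α → α} (hY : Measurable Y) :
      Integrable (fun z => (K (Y z)).real A) γ :=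
    Integrable.of_bound (hKA.comp hY).aestronglyMeasurable 1 (ae_of_all _ fun z => by
      rw [Real.norm_of_nonneg measureReal_nonneg]; exact measureReal_le_one)
  rw [hb, hb, Measure.fst, Measure.snd,
    integral_map measurable_fst.aemeasurable hKA.aestronglyMeasurable,
    integral_map measurable_snd.aemeasurable hKA.aestronglyMeasurable,
    ← integral_sub (hint measurable_fst) (hint measurable_snd),
    ← lintegral_const_mul _ (show Measurable fun z : α × α => ENNReal.ofReal (ψ z.1 z.2) from
      hψ.ennreal_ofReal)]
  rw [← Real.norm_eq_abs, ofReal_norm]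
  refine (enorm_integral_le_lintegral_enorm _).trans (lintegral_mono fun z => ?_)
  rw [← ofReal_norm, Real.norm_eq_abs, ← ENNReal.ofReal_coe_nnreal,
    ← ENNReal.ofReal_mul L.coe_nonneg]
  exact ENNReal.ofReal_le_ofReal (hL A hA _ _)

lemma geometricBound_tvDist [IsMarkovKernel K] (hf : Measurable (Function.uncurry f))
    (hK : ∀ x, K x = ν.map (f x)) (hπ : π.bind K = π) (hψ : Measurable (Function.uncurry ψ))
    (hρ : 0 < ρ)
    (hc : ∀ b b', ∫⁻ ξ, ENNReal.ofReal (ψ (f b ξ) (f b' ξ)) ^ 2 ∂ν ≤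
      ENNReal.ofReal ρ ^ 2 * ENNReal.ofReal (ψ b b') ^ 2)
    (hfin : ∀ x, ∫⁻ b, ENNReal.ofReal (ψ x b) ^ 2 ∂π ≠ ∞) {L : ℝ≥0}
    (hL : ∀ A, MeasurableSet A → ∀ b b', |(K b).real A - (K b').real A| ≤ L * ψ b b') :
    GeometricBound tvDist K π ρ := by
  obtain ⟨M, hM⟩ := exists_coupling_lintegral_le hf hK hπ
    (d := fun b b' => ENNReal.ofReal (ψ b b')) hψ.ennreal_ofReal hc hfin
  have hr : ENNReal.ofReal ρ ≠ 0 := by simpa using hρ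
  -- The summand 1 serves m = 0. The factor 1/ρ pays for the transition spent on smoothing, which
  -- yields only ρ ^ m at time m + 1.
  refine ⟨fun x => 1 + L * M x * (Real.toNNReal ρ)⁻¹, fun m x => ?_⟩
  rcases m with _ | m
  · rw [pow_zero, pow_zero, mul_one]
    have : IsProbabilityMeasure ((1 : Kernel α α) x) := by
      rw [show (1 : Kernel α α) x = Measure.dirac x from rfl]; infer_instance
    refine (tvDist_le_one _ _).trans ?_
    push_cast
    exact le_self_add
  · obtain ⟨γ, hγ, hle⟩ := hM m x
    have h := tvDist_bind_le hγ hψ hL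
    rw [hπ] at h
    rw [kernel_pow_succ_apply]
    refine h.trans ?_
    calc (L : ℝ≥0∞) * ∫⁻ z, ENNReal.ofReal (ψ z.1 z.2) ∂γ
        ≤ L * (M x * ENNReal.ofReal ρ ^ m) := by gcongr
      _ = (L * M x * (ENNReal.ofReal ρ)⁻¹) * ENNReal.ofReal ρ ^ (m + 1) := by
        rw [pow_succ', mul_assoc _ (_)⁻¹, ← mul_assoc (_)⁻¹,
          ENNReal.inv_mul_cancel hr ENNReal.ofReal_ne_top, one_mul, mul_assoc]
      _ ≤ _ := by
        gcongr
        have hr' : Real.toNNReal ρ ≠ 0 := by simpa using hρ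
        push_cast [ENNReal.coe_inv hr']
        exact le_add_self

end RandomMap

/-! ### The standard normal density and distribution function -/

section NormalCDF

/-- The standard normal density. -/
def stdNormalPDF (x : ℝ) : ℝ := gaussianPDFReal 0 1 x

lemma stdNormalPDF_eq (x : ℝ) :
    stdNormalPDF x = (√(2 * Real.pi))⁻¹ * Real.exp (-x ^ 2 / 2) := by
  simp [stdNormalPDF, gaussianPDFReal_def]

lemma stdNormalPDF_pos (x : ℝ) : 0 < stdNormalPDF x := gaussianPDFReal_pos _ _ _ one_ne_zero

lemma stdNormalPDF_neg (x : ℝ) : stdNormalPDF (-x) = stdNormalPDF x := by simp [stdNormalPDF_eq]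

lemma hasDerivAt_stdNormalPDF (x : ℝ) : HasDerivAt stdNormalPDF (-x * stdNormalPDF x) x := by
  have h : HasDerivAt (fun x : ℝ => (√(2 * Real.pi))⁻¹ * Real.exp (-x ^ 2 / 2))
      ((√(2 * Real.pi))⁻¹ * (Real.exp (-x ^ 2 / 2) * (-(2 * x) / 2))) x := by
    refine ((HasDerivAt.div_const ?_ 2).exp).const_mul _
    simpa using (hasDerivAt_pow 2 x).fun_neg
  rw [show stdNormalPDF = _ from funext stdNormalPDF_eq]
  exact h.congr_deriv (by ring)

lemma continuous_stdNormalPDF : Continuous stdNormalPDF :=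
  continuous_iff_continuousAt.2 fun x => (hasDerivAt_stdNormalPDF x).continuousAt

lemma gaussianPDFReal_one_eq (t z : ℝ) : gaussianPDFReal t 1 z = stdNormalPDF (z - t) := by
  simp [stdNormalPDF_eq, gaussianPDFReal_def]

lemma stdNormalCDF_eq_integral (t : ℝ) : stdNormalCDF t = ∫ x in Set.Iic t, stdNormalPDF x := by
  rw [stdNormalCDF, cdf_eq_real, Measure.real, gaussianReal_apply_eq_integral _ one_ne_zero,
    ENNReal.toReal_ofReal]
  · rfl
  · exact integral_nonneg fun x => gaussianPDFReal_nonneg _ _ _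

lemma hasDerivAt_stdNormalCDF (t : ℝ) : HasDerivAt stdNormalCDF (stdNormalPDF t) t := by
  have hi : Integrable stdNormalPDF := integrable_gaussianPDFReal 0 1
  have h : stdNormalCDF = fun u => (∫ x in (0 : ℝ)..u, stdNormalPDF x) + stdNormalCDF 0 := by
    funext u
    rw [← intervalIntegral.integral_Iic_sub_Iic hi.integrableOn hi.integrableOn,
      ← stdNormalCDF_eq_integral, ← stdNormalCDF_eq_integral, sub_add_cancel]
  rw [h]
  exact (intervalIntegral.integral_hasDerivAt_right (hi.intervalIntegrable)
    (continuous_stdNormalPDF.stronglyMeasurableAtFilter _ _)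
    continuous_stdNormalPDF.continuousAt).add_const _

lemma continuous_stdNormalCDF : Continuous stdNormalCDF :=
  continuous_iff_continuousAt.2 fun x => (hasDerivAt_stdNormalCDF x).continuousAt

lemma strictMono_stdNormalCDF : StrictMono stdNormalCDF :=
  strictMono_of_deriv_pos fun x => by
    rw [(hasDerivAt_stdNormalCDF x).deriv]; exact stdNormalPDF_pos x

lemma stdNormalCDF_pos (t : ℝ) : 0 < stdNormalCDF t :=
  lt_of_le_of_lt (cdf_nonneg (gaussianReal 0 1) (t - 1)) (strictMono_stdNormalCDF (by linarith))

lemma stdNormalCDF_lt_one (t : ℝ) : stdNormalCDF t < 1 :=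
  lt_of_lt_of_le (strictMono_stdNormalCDF (show t < t + 1 by linarith)) (cdf_le_one _ _)

lemma gaussianReal_Ici (μ z : ℝ) :
    gaussianReal μ 1 (Set.Ici z) = ENNReal.ofReal (stdNormalCDF (μ - z)) := by
  have h : gaussianReal μ 1 = (gaussianReal 0 1).map fun x => μ - x := by
    rw [gaussianReal_map_const_sub, sub_zero]
  rw [h, Measure.map_apply (by fun_prop) measurableSet_Ici, stdNormalCDF, ofReal_cdf]
  congr 1
  ext x
  simp only [Set.mem_preimage, Set.mem_Ici, Set.mem_Iic]
  constructor <;> intro h <;> linarith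

lemma gaussianReal_Ioi (μ z : ℝ) :
    gaussianReal μ 1 (Set.Ioi z) = ENNReal.ofReal (stdNormalCDF (μ - z)) := by
  have := nullSingletonClass_gaussianReal (μ := μ) (v := 1) one_ne_zero
  rw [← gaussianReal_Ici]
  exact measure_congr Ioi_ae_eq_Ici

lemma gaussianReal_halfLine (μ : ℝ) (a : Bool) : gaussianReal μ 1 (halfLine a) =
    ENNReal.ofReal (if a then stdNormalCDF μ else 1 - stdNormalCDF μ) := by
  cases a
  · have h : Set.Iio (0 : ℝ) = (Set.Ici 0)ᶜ := by ext; simp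
    simp only [halfLine, Bool.false_eq_true, if_false]
    rw [h, prob_compl_eq_one_sub measurableSet_Ici, gaussianReal_Ici, sub_zero,
      ENNReal.ofReal_sub _ (stdNormalCDF_pos μ).le, ENNReal.ofReal_one]
  · simp [halfLine, gaussianReal_Ioi]

lemma stdNormalCDF_neg (μ : ℝ) : stdNormalCDF (-μ) = 1 - stdNormalCDF μ := by
  have h1 : gaussianReal (-μ) 1 (halfLine true) = gaussianReal μ 1 (halfLine false) := by
    rw [← gaussianReal_map_neg, Measure.map_apply (by fun_prop) (measurableSet_halfLine _)]
    congr 1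
    ext x; simp [halfLine]
  rw [gaussianReal_halfLine, gaussianReal_halfLine] at h1
  simp only [if_true, Bool.false_eq_true, if_false] at h1
  exact (ENNReal.ofReal_eq_ofReal_iff (stdNormalCDF_pos _).le
    (by linarith [stdNormalCDF_lt_one μ])).1 h1

end NormalCDF

/-! ### Moments of the truncated normal law and log-concavity of Φ -/

section TruncatedMoments

lemma integrable_pow_mul_stdNormalPDF (t : ℝ) (k : ℕ) :
    Integrable fun z => z ^ k * stdNormalPDF (z - t) := by
  have h1 : Integrable (fun z : ℝ => z ^ k) (gaussianReal t 1) := by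
    rcases eq_or_ne k 0 with rfl | hk
    · simp
    · have := (memLp_id_gaussianReal (μ := t) (v := 1) (k : ℝ≥0))
      have h2 := MemLp.integrable_norm_pow (by exact_mod_cast this) hk
      refine (integrable_norm_iff (by fun_prop)).1 (h2.congr (ae_of_all _ fun z => ?_))
      simp
  rw [gaussianReal_of_var_ne_zero _ one_ne_zero, integrable_withDensity_iff_integrable_smul₀'
    (by fun_prop) (ae_of_all _ fun _ => gaussianPDF_lt_top)] at h1
  refine h1.congr (ae_of_all _ fun z => ?_)
  simp [gaussianPDF, gaussianPDFReal_one_eq, mul_comm, (stdNormalPDF_pos (z - t)).le]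

/-- The unnormalized moments of the normal distribution truncated to the positive half-line. -/
def partialMoment (k : ℕ) (t : ℝ) : ℝ := ∫ z in Set.Ioi 0, z ^ k * stdNormalPDF (z - t)

lemma partialMoment_nonneg (k : ℕ) (t : ℝ) : 0 ≤ partialMoment k t :=
  setIntegral_nonneg measurableSet_Ioi fun _ hz =>
    mul_nonneg (pow_nonneg (le_of_lt hz) _) (stdNormalPDF_pos _).le

lemma partialMoment_zero (t : ℝ) : partialMoment 0 t = stdNormalCDF t := by
  have h := gaussianReal_Ioi t 0
  rw [gaussianReal_apply_eq_integral _ one_ne_zero, sub_zero,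
    ENNReal.ofReal_eq_ofReal_iff (integral_nonneg fun x => gaussianPDFReal_nonneg _ _ _)
      (stdNormalCDF_pos _).le] at h
  rw [← h]
  simp [partialMoment, gaussianPDFReal_one_eq]

lemma partialMoment_one (t : ℝ) :
    partialMoment 1 t = t * stdNormalCDF t + stdNormalPDF t := by
  have hd (z : ℝ) : HasDerivAt (fun z => stdNormalPDF (z - t))
      (-(z - t) * stdNormalPDF (z - t)) z := by
    simpa using (hasDerivAt_stdNormalPDF (z - t)).comp_sub_const z t
  have hi0 := integrable_pow_mul_stdNormalPDF t 0
  have hi1 := integrable_pow_mul_stdNormalPDF t 1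
  simp only [pow_zero, one_mul, pow_one] at hi0 hi1
  have hi : Integrable fun z => -(z - t) * stdNormalPDF (z - t) := by
    refine ((hi0.const_mul t).sub hi1).congr (ae_of_all _ fun z => ?_)
    simp only [Pi.sub_apply]; ring
  have h := integral_Ioi_of_hasDerivAt_of_tendsto' (a := 0) (fun z _ => hd z) hi.integrableOn
    (tendsto_zero_of_hasDerivAt_of_integrableOn_Ioi (a := 0) (fun z _ => hd z) hi.integrableOn
      hi0.integrableOn)
  have h2 : ∫ z in Set.Ioi 0, -(z - t) * stdNormalPDF (z - t) =
      t * partialMoment 0 t - partialMoment 1 t := by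
    rw [partialMoment, partialMoment, ← integral_const_mul, ← integral_sub]
    · refine integral_congr_ae (ae_of_all _ fun z => ?_); simp only [pow_zero, pow_one]; ring
    · simpa [IntegrableOn] using (hi0.const_mul t).integrableOn (s := Set.Ioi 0)
    · simpa [IntegrableOn] using hi1.integrableOn (s := Set.Ioi 0)
  rw [h2, partialMoment_zero, zero_sub, zero_sub, stdNormalPDF_neg] at h
  linarith

/-- Integration by parts. -/
lemma partialMoment_add_two (k : ℕ) (t : ℝ) :
    partialMoment (k + 2) t = t * partialMoment (k + 1) t + (k + 1) * partialMoment k t := by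
  have hd (z : ℝ) : HasDerivAt (fun z => z ^ (k + 1) * stdNormalPDF (z - t))
      ((k + 1) * (z ^ k * stdNormalPDF (z - t)) + t * (z ^ (k + 1) * stdNormalPDF (z - t))
        - z ^ (k + 2) * stdNormalPDF (z - t)) z := by
    have h1 : HasDerivAt (fun z => stdNormalPDF (z - t))
        (-(z - t) * stdNormalPDF (z - t)) z := by
      simpa using (hasDerivAt_stdNormalPDF (z - t)).comp_sub_const z t
    refine ((hasDerivAt_pow (k + 1) z).fun_mul h1).congr_deriv ?_
    push_cast
    ring
  have hi0 := integrable_pow_mul_stdNormalPDF t k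
  have hi1 := integrable_pow_mul_stdNormalPDF t (k + 1)
  have hi2 := integrable_pow_mul_stdNormalPDF t (k + 2)
  have hi01 : Integrable fun z => (k + 1) * (z ^ k * stdNormalPDF (z - t)) +
      t * (z ^ (k + 1) * stdNormalPDF (z - t)) := (hi0.const_mul ((k : ℝ) + 1)).add (hi1.const_mul t)
  have hi := hi01.sub hi2
  have h := integral_Ioi_of_hasDerivAt_of_tendsto' (a := 0) (fun z _ => hd z) hi.integrableOn
    (tendsto_zero_of_hasDerivAt_of_integrableOn_Ioi (a := 0) (fun z _ => hd z) hi.integrableOn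
      hi1.integrableOn)
  rw [integral_sub hi01.integrableOn hi2.integrableOn,
    integral_add (hi0.const_mul ((k : ℝ) + 1)).integrableOn (hi1.const_mul t).integrableOn,
    integral_const_mul, integral_const_mul] at h
  simp only [ne_eq, Nat.add_eq_zero_iff, one_ne_zero, and_false, not_false_eq_true, zero_pow,
    zero_mul, sub_zero] at h
  change ((k : ℝ) + 1) * partialMoment k t + t * partialMoment (k + 1) t -
    partialMoment (k + 2) t = 0 at h
  linarith

/-- Integration of z (z - a)² ≥ 0 over the half-line; the parameter a is free to be optimized. -/
lemma partialMoment_two_le (t a : ℝ) :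
    2 * a * partialMoment 2 t ≤ partialMoment 3 t + a ^ 2 * partialMoment 1 t := by
  have hi1 := (integrable_pow_mul_stdNormalPDF t 1).integrableOn (s := Set.Ioi 0)
  have hi2 := (integrable_pow_mul_stdNormalPDF t 2).integrableOn (s := Set.Ioi 0)
  have hi3 := (integrable_pow_mul_stdNormalPDF t 3).integrableOn (s := Set.Ioi 0)
  unfold partialMoment
  rw [← integral_const_mul, ← integral_const_mul, ← integral_add hi3 (hi1.const_mul _)]
  refine setIntegral_mono_on (hi2.const_mul _) (hi3.add (hi1.const_mul _)) measurableSet_Ioi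
    fun z hz => ?_
  have hz : 0 < z := hz
  have := mul_nonneg (mul_nonneg hz.le (sq_nonneg (z - a))) (stdNormalPDF_pos (z - t)).le
  nlinarith

/-- For `t ≤ 0` the variance of the normal distribution `N(t, 1)` truncated to `(0, ∞)` is bounded
away from one. -/
lemma stdNormalCDF_sq_le {t : ℝ} (ht : t ≤ 0) :
    (1 / 4) * stdNormalCDF t ^ 2 ≤ stdNormalPDF t * partialMoment 1 t := by
  have h0 := partialMoment_zero t
  have h1 := partialMoment_one t
  have h2 := partialMoment_add_two 0 t
  have h3 := partialMoment_add_two 1 t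
  -- Write m_k for the moments. Since m₃ ≤ 2 m₁, parameter a gives m₂ ≤ (2 + a²)/(2a) m₁, which is
  -- best at a = √2. The rational value 3/2 gives the constant 17/12.
  have hc := partialMoment_two_le t (3 / 2)
  norm_num at h2 h3
  have n1 := partialMoment_nonneg 1 t
  have n2 := partialMoment_nonneg 2 t
  have hΦ := stdNormalCDF_pos t
  -- The term t m₂ in the recurrence for m₃ is dropped because t ≤ 0.
  have h4 : partialMoment 3 t ≤ 2 * partialMoment 1 t := by nlinarith
  have h5 : partialMoment 2 t ≤ 17 / 12 * partialMoment 1 t := by linarith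
  have h6 : stdNormalCDF t ≤ (17 / 12 - t) * partialMoment 1 t := by linarith
  have h7 : stdNormalPDF t = partialMoment 1 t - t * stdNormalCDF t := by linarith
  rw [h7]
  -- Inserting Φ² ≤ (17/12 - t) Φ m₁ reduces the claim to m₁² - (17/12) Φ m₁ + (3/4) Φ² ≥ 0, a
  -- quadratic form with negative discriminant (17/12)² - 3.
  nlinarith [sq_nonneg (stdNormalCDF t - 2 * partialMoment 1 t), mul_le_mul_of_nonneg_left h6 hΦ.le,
    mul_nonneg (mul_nonneg (neg_nonneg.2 ht) hΦ.le) n1,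
    sq_nonneg (stdNormalCDF t - 17 / 12 * partialMoment 1 t)]

/-- The mean of the normal distribution `N(t, 1)` truncated to `(0, ∞)`. -/
def posTruncMean (t : ℝ) : ℝ := partialMoment 1 t / stdNormalCDF t

/-- The derivative is the variance of the truncated law. It never exceeds 1, and
`stdNormalCDF_sq_le` bounds it by 3/4 for t ≤ 0. -/
lemma hasDerivAt_posTruncMean (t : ℝ) : HasDerivAt posTruncMean
    (1 - stdNormalPDF t * partialMoment 1 t / stdNormalCDF t ^ 2) t := by
  have hΦ := (stdNormalCDF_pos t).ne'
  have h1 : posTruncMean = fun t => t + stdNormalPDF t / stdNormalCDF t := by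
    funext t
    have := (stdNormalCDF_pos t).ne'
    rw [posTruncMean, partialMoment_one]
    field_simp
  rw [h1]
  refine ((hasDerivAt_id' t).fun_add
    ((hasDerivAt_stdNormalPDF t).fun_div (hasDerivAt_stdNormalCDF t) hΦ)).congr_deriv ?_
  rw [partialMoment_one]
  field_simp
  ring

/-- Of the locations x and -x one is nonpositive, so the two variances sum to at most 3/4 + 1.
Neither response suffices alone, since the variance tends to 1 as the location tends to +∞. -/
lemma posTruncMean_sub_add_le {s t : ℝ} (hst : s ≤ t) :
    (posTruncMean t - posTruncMean s) + (posTruncMean (-s) - posTruncMean (-t)) ≤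
      7 / 4 * (t - s) := by
  have hd (x : ℝ) : HasDerivAt (fun x => posTruncMean x - posTruncMean (-x))
      ((1 - stdNormalPDF x * partialMoment 1 x / stdNormalCDF x ^ 2) +
        (1 - stdNormalPDF (-x) * partialMoment 1 (-x) / stdNormalCDF (-x) ^ 2)) x := by
    have h2 : HasDerivAt (fun x => posTruncMean (-x)) _ x :=
      (hasDerivAt_posTruncMean (-x)).comp x (hasDerivAt_neg x)
    exact ((hasDerivAt_posTruncMean x).fun_sub h2).congr_deriv (by ring)
  have hb (x : ℝ) : 0 ≤ stdNormalPDF x * partialMoment 1 x / stdNormalCDF x ^ 2 :=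
    div_nonneg (mul_nonneg (stdNormalPDF_pos x).le (partialMoment_nonneg 1 x)) (sq_nonneg _)
  have hb' (x : ℝ) (hx : x ≤ 0) :
      1 / 4 ≤ stdNormalPDF x * partialMoment 1 x / stdNormalCDF x ^ 2 := by
    rw [le_div_iff₀ (pow_pos (stdNormalCDF_pos x) 2)]
    exact stdNormalCDF_sq_le hx
  have := image_sub_le_mul_sub_of_deriv_le (fun x => (hd x).differentiableAt) (C := 7 / 4)
    (fun x => by
      rw [(hd x).deriv]
      rcases le_total x 0 with hx | hx
      · linarith [hb' x hx, hb (-x)]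
      · linarith [hb' (-x) (by linarith), hb x]) hst
  linarith

/-- The logarithmic derivative φ/Φ decreases because its own derivative is -φ m₁/Φ², where m₁ ≥ 0 is
the first partial moment. -/
lemma concaveOn_log_stdNormalCDF :
    ConcaveOn ℝ Set.univ fun t => Real.log (stdNormalCDF t) := by
  have hd (t : ℝ) : HasDerivAt (fun t => Real.log (stdNormalCDF t))
      (stdNormalPDF t / stdNormalCDF t) t :=
    (hasDerivAt_stdNormalCDF t).log (stdNormalCDF_pos t).ne'
  have hd2 (t : ℝ) := (hasDerivAt_stdNormalPDF t).div (hasDerivAt_stdNormalCDF t)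
    (stdNormalCDF_pos t).ne'
  refine Antitone.concaveOn_univ_of_deriv (fun t => (hd t).differentiableAt) ?_
  rw [show deriv _ = fun t => stdNormalPDF t / stdNormalCDF t from funext fun t => (hd t).deriv]
  refine antitone_of_deriv_nonpos (fun t => (hd2 t).differentiableAt) fun t => ?_
  have e := (hd2 t).deriv
  change deriv (fun t => stdNormalPDF t / stdNormalCDF t) t = _ at e
  rw [e]
  refine div_nonpos_of_nonpos_of_nonneg ?_ (sq_nonneg _)
  have h := partialMoment_one t
  have := mul_nonneg (stdNormalPDF_pos t).le (partialMoment_nonneg 1 t)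
  rw [h] at this
  linarith

end TruncatedMoments

/-! ### Quantile coupling of truncated normal laws -/

section TruncatedQuantile

/-- The uniform distribution on the unit interval. -/
def unif : Measure ℝ := volume.restrict (Set.Ioo 0 1)

instance : IsProbabilityMeasure unif := ⟨by simp [unif]⟩

lemma unif_Iic_mul (c : ℝ) (hc : 0 ≤ c) (hc1 : c ≤ 1) : unif (Set.Iic c) = ENNReal.ofReal c := by
  rw [unif, Measure.restrict_apply measurableSet_Iic]
  rcases hc1.eq_or_lt with rfl | h
  · rw [Set.inter_eq_right.2 fun x hx => hx.2.le]; simp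
  · rw [show Set.Iic c ∩ Set.Ioo 0 1 = Set.Ioc 0 c by
      ext x; simp only [Set.mem_inter_iff, Set.mem_Iic, Set.mem_Ioo, Set.mem_Ioc]
      constructor
      · rintro ⟨h1, h2, h3⟩; exact ⟨h2, h1⟩
      · rintro ⟨h1, h2⟩; exact ⟨h2, h1, by linarith⟩]
    simp

lemma exists_stdNormalCDF_eq {u : ℝ} (hu : u ∈ Set.Ioo (0 : ℝ) 1) : ∃ t, stdNormalCDF t = u := by
  obtain ⟨a, ha⟩ := ((tendsto_cdf_atBot (gaussianReal 0 1)).eventually (gt_mem_nhds hu.1)).exists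
  obtain ⟨b, hb⟩ := ((tendsto_cdf_atTop (gaussianReal 0 1)).eventually (lt_mem_nhds hu.2)).exists
  exact mem_range_of_exists_le_of_exists_ge continuous_stdNormalCDF ⟨a, ha.le⟩ ⟨b, hb.le⟩

open Classical in
/-- The standard normal quantile function, extended by `0` outside `(0, 1)`. -/
def stdNormalQuantile (u : ℝ) : ℝ :=
  if hu : u ∈ Set.Ioo (0 : ℝ) 1 then (exists_stdNormalCDF_eq hu).choose else 0

lemma stdNormalCDF_quantile {u : ℝ} (hu : u ∈ Set.Ioo (0 : ℝ) 1) :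
    stdNormalCDF (stdNormalQuantile u) = u := by
  rw [stdNormalQuantile, dif_pos hu]
  exact (exists_stdNormalCDF_eq hu).choose_spec

lemma measurable_stdNormalQuantile : Measurable stdNormalQuantile := by
  refine measurable_of_Iic fun t => ?_
  have h : stdNormalQuantile ⁻¹' Set.Iic t =
      (Set.Ioo 0 1 ∩ Set.Iic (stdNormalCDF t)) ∪ ((Set.Ioo 0 1)ᶜ ∩ {_u | 0 ≤ t}) := by
    ext u
    by_cases hu : u ∈ Set.Ioo (0 : ℝ) 1
    · have := strictMono_stdNormalCDF.le_iff_le (a := stdNormalQuantile u) (b := t)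
      rw [stdNormalCDF_quantile hu] at this
      simp only [Set.mem_preimage, Set.mem_Iic, Set.mem_union, Set.mem_inter_iff, hu, true_and,
        Set.mem_compl_iff, not_true, false_and, or_false, this]
    · simp only [Set.mem_preimage, Set.mem_Iic, Set.mem_union, Set.mem_inter_iff, hu, false_and,
        Set.mem_compl_iff, not_false_iff, true_and, false_or, Set.mem_ofPred_eq]
      rw [stdNormalQuantile, dif_neg hu]
  rw [h]
  exact (measurableSet_Ioo.inter measurableSet_Iic).union
    (measurableSet_Ioo.compl.inter (MeasurableSet.const _))

/-- The quantile transform of `N(t, 1)` truncated to the positive half-line. -/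
def posTruncQuantile (t u : ℝ) : ℝ := t - stdNormalQuantile (u * stdNormalCDF t)

/-- The quantile transform of `N(t, 1)` truncated to a half-line. -/
def truncQuantile (a : Bool) (t u : ℝ) : ℝ :=
  if a then posTruncQuantile t u else -posTruncQuantile (-t) u

lemma measurable_posTruncQuantile : Measurable fun w : ℝ × ℝ => posTruncQuantile w.1 w.2 :=
  measurable_fst.sub (measurable_stdNormalQuantile.comp
    (measurable_snd.mul (continuous_stdNormalCDF.measurable.comp measurable_fst)))

lemma measurable_truncQuantile (a : Bool) :
    Measurable fun w : ℝ × ℝ => truncQuantile a w.1 w.2 := by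
  cases a
  · simp only [truncQuantile, Bool.false_eq_true, if_false]
    exact (measurable_posTruncQuantile.comp (measurable_fst.neg.prodMk measurable_snd)).neg
  · simpa only [truncQuantile, if_true] using measurable_posTruncQuantile

lemma mul_stdNormalCDF_mem {u : ℝ} (hu : u ∈ Set.Ioo (0 : ℝ) 1) (t : ℝ) :
    u * stdNormalCDF t ∈ Set.Ioo (0 : ℝ) 1 :=
  ⟨mul_pos hu.1 (stdNormalCDF_pos t),
    mul_lt_one_of_nonneg_of_lt_one_left hu.1.le hu.2 (stdNormalCDF_lt_one t).le⟩

/-- Here u acts as an upper-tail probability: for z ≥ 0 the ratio on the right is the probability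
that the truncated variable is at least z. A uniform u therefore produces the truncated law. -/
lemma le_posTruncQuantile_iff {u : ℝ} (hu : u ∈ Set.Ioo (0 : ℝ) 1) (t z : ℝ) :
    z ≤ posTruncQuantile t u ↔ u ≤ stdNormalCDF (t - z) / stdNormalCDF t := by
  rw [le_div_iff₀ (stdNormalCDF_pos t), ← stdNormalCDF_quantile (mul_stdNormalCDF_mem hu t),
    strictMono_stdNormalCDF.le_iff_le, posTruncQuantile]
  constructor <;> intro h <;> linarith

lemma map_posTruncQuantile (t : ℝ) : unif.map (posTruncQuantile t) = truncNormal t true := by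
  have hm : Measurable (posTruncQuantile t) :=
    measurable_posTruncQuantile.comp measurable_prodMk_left
  have : IsProbabilityMeasure (unif.map (posTruncQuantile t)) :=
    Measure.isProbabilityMeasure_map hm.aemeasurable
  refine Measure.ext_of_Ici _ _ fun z => ?_
  have hΦ := stdNormalCDF_pos t
  rw [Measure.map_apply hm measurableSet_Ici, truncNormal, cond_apply (measurableSet_halfLine _),
    gaussianReal_halfLine]
  have e1 : unif (posTruncQuantile t ⁻¹' Set.Ici z) =
      unif (Set.Iic (stdNormalCDF (t - z) / stdNormalCDF t)) := by
    refine measure_congr ?_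
    rw [unif]
    filter_upwards [ae_restrict_mem measurableSet_Ioo] with u hu
    exact propext (le_posTruncQuantile_iff hu t z)
  rw [e1]
  simp only [if_true, halfLine]
  rcases le_or_gt z 0 with hz | hz
  · rw [Set.inter_eq_left.2 (show Set.Ioi 0 ⊆ Set.Ici z from fun x hx => hz.trans (le_of_lt hx)), gaussianReal_Ioi, sub_zero,
      ENNReal.inv_mul_cancel (by simpa using hΦ) ENNReal.ofReal_ne_top]
    refine le_antisymm prob_le_one ?_
    calc (1 : ℝ≥0∞) = unif (Set.Iic 1) := by rw [unif_Iic_mul 1 zero_le_one le_rfl]; simp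
      _ ≤ _ := measure_mono (Set.Iic_subset_Iic.2 ?_)
    rw [le_div_iff₀ hΦ, one_mul]
    exact strictMono_stdNormalCDF.monotone (by linarith)
  · rw [Set.inter_eq_right.2 (show Set.Ici z ⊆ Set.Ioi 0 from fun x hx => lt_of_lt_of_le hz hx),
      gaussianReal_Ici, unif_Iic_mul,
      div_eq_inv_mul, ENNReal.ofReal_mul (inv_nonneg.2 hΦ.le), ENNReal.ofReal_inv_of_pos hΦ]
    · exact div_nonneg (stdNormalCDF_pos _).le hΦ.le
    · rw [div_le_one hΦ]
      exact strictMono_stdNormalCDF.monotone (by linarith)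

lemma map_neg_truncNormal (t : ℝ) :
    (truncNormal (-t) true).map (fun x => -x) = truncNormal t false := by
  have e : gaussianReal (-t) 1 = (gaussianReal t 1).map fun x => -x := gaussianReal_map_neg.symm
  ext s hs
  have hpre : (fun x : ℝ => -x) ⁻¹' halfLine true = halfLine false := by ext; simp [halfLine]
  rw [Measure.map_apply measurable_neg hs, truncNormal, truncNormal,
    cond_apply (measurableSet_halfLine _), cond_apply (measurableSet_halfLine _), e,
    Measure.map_apply measurable_neg (measurableSet_halfLine _),
    Measure.map_apply measurable_neg ((measurableSet_halfLine _).inter (measurable_neg hs)),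
    Set.preimage_inter, hpre, ← Set.preimage_comp]
  simp

lemma map_truncQuantile (a : Bool) (t : ℝ) :
    unif.map (truncQuantile a t) = truncNormal t a := by
  cases a
  · have hm : Measurable (posTruncQuantile (-t)) :=
      measurable_posTruncQuantile.comp measurable_prodMk_left
    rw [← map_neg_truncNormal, ← map_posTruncQuantile, Measure.map_map measurable_neg hm]
    rfl
  · exact map_posTruncQuantile t

/-- The quantile transform of the truncated normal distribution is nondecreasing and
nonexpansive in the location. -/
lemma posTruncQuantile_sub {u : ℝ} (hu : u ∈ Set.Ioo (0 : ℝ) 1) {s t : ℝ} (hst : s ≤ t) :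
    0 ≤ posTruncQuantile t u - posTruncQuantile s u ∧
      posTruncQuantile t u - posTruncQuantile s u ≤ t - s := by
  set w := stdNormalQuantile (u * stdNormalCDF t) with hw
  set w' := stdNormalQuantile (u * stdNormalCDF s) with hw'
  have ew : stdNormalCDF w = u * stdNormalCDF t := stdNormalCDF_quantile (mul_stdNormalCDF_mem hu t)
  have ew' : stdNormalCDF w' = u * stdNormalCDF s :=
    stdNormalCDF_quantile (mul_stdNormalCDF_mem hu s)
  have hle : w' ≤ w := by
    rw [← strictMono_stdNormalCDF.le_iff_le, ew, ew']
    exact mul_le_mul_of_nonneg_left (strictMono_stdNormalCDF.monotone hst) hu.1.le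
  have hws : w' < s := by
    rw [← strictMono_stdNormalCDF.lt_iff_lt, ew']
    exact mul_lt_of_lt_one_left (stdNormalCDF_pos s) hu.2
  have e1 : posTruncQuantile t u - posTruncQuantile s u = (t - s) - (w - w') := by
    rw [posTruncQuantile, posTruncQuantile, ← hw, ← hw']; ring
  rw [e1]
  refine ⟨?_, by linarith⟩
  rcases hst.eq_or_lt with rfl | hst'
  · simp [hw, hw']
  -- With F = log Φ, the increment of F from w' to w equals that from s to t. As w' < s, concavity
  -- makes F rise at least as much over the length t - s starting at w', so w is reached within that
  -- length.
  have hkey : w ≤ w' + (t - s) := by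
    set F := fun t => Real.log (stdNormalCDF t) with hF
    have e2 : F w - F w' = F t - F s := by
      simp only [hF, ew, ew', Real.log_mul hu.1.ne' (stdNormalCDF_pos _).ne']
      ring
    have hmono : F w ≤ F (w' + (t - s)) := by
      have hd : 0 < t - w' := by linarith
      have hc := concaveOn_log_stdNormalCDF.2
      -- The points s and w' + (t - s) are convex combinations of w' and t with interchanged
      -- weights; adding the two concavity inequalities gives F w' + F t ≤ F s + F (w' + (t - s)).
      have a1 := hc (Set.mem_univ w') (Set.mem_univ t)
        (a := (t - s) / (t - w')) (b := (s - w') / (t - w'))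
        (div_nonneg (by linarith) hd.le) (div_nonneg (by linarith) hd.le)
        (by field_simp; ring)
      have a2 := hc (Set.mem_univ w') (Set.mem_univ t)
        (a := (s - w') / (t - w')) (b := (t - s) / (t - w'))
        (div_nonneg (by linarith) hd.le) (div_nonneg (by linarith) hd.le)
        (by field_simp; ring)
      simp only [smul_eq_mul] at a1 a2
      rw [show (t - s) / (t - w') * w' + (s - w') / (t - w') * t = s by field_simp; ring] at a1
      rw [show (s - w') / (t - w') * w' + (t - s) / (t - w') * t = w' + (t - s) by
        field_simp; ring] at a2
      have hs1 : (t - s) / (t - w') + (s - w') / (t - w') = 1 := by field_simp; ring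
      change _ ≤ F s at a1
      change _ ≤ F (w' + (t - s)) at a2
      change _ * F w' + _ * F t ≤ _ at a1
      change _ * F w' + _ * F t ≤ _ at a2
      have : ((t - s) / (t - w') + (s - w') / (t - w')) * (F w' + F t) = F w' + F t := by
        rw [hs1, one_mul]
      linarith
    rw [← strictMono_stdNormalCDF.le_iff_le]
    exact (Real.log_le_log_iff (stdNormalCDF_pos _) (stdNormalCDF_pos _)).1 hmono
  linarith

lemma truncQuantile_sub (a : Bool) {u : ℝ} (hu : u ∈ Set.Ioo (0 : ℝ) 1) {s t : ℝ} (hst : s ≤ t) :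
    0 ≤ truncQuantile a t u - truncQuantile a s u ∧
      truncQuantile a t u - truncQuantile a s u ≤ t - s := by
  cases a
  · simp only [truncQuantile, Bool.false_eq_true, if_false]
    have h := posTruncQuantile_sub hu (neg_le_neg hst)
    exact ⟨by linarith, by linarith⟩
  · exact posTruncQuantile_sub hu hst

lemma abs_truncQuantile_sub_le (a : Bool) {u : ℝ} (hu : u ∈ Set.Ioo (0 : ℝ) 1) (s t : ℝ) :
    |truncQuantile a t u - truncQuantile a s u| ≤ |t - s| := by
  rcases le_total s t with h | h
  · have := truncQuantile_sub a hu h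
    rw [abs_of_nonneg this.1, abs_of_nonneg (sub_nonneg.2 h)]
    exact this.2
  · have := truncQuantile_sub a hu h
    rw [abs_sub_comm, abs_sub_comm t]
    rw [abs_of_nonneg this.1, abs_of_nonneg (sub_nonneg.2 h)]
    exact this.2

lemma integral_id_truncNormal_true (t : ℝ) : ∫ z, z ∂truncNormal t true = posTruncMean t := by
  rw [truncNormal, ProbabilityTheory.cond, integral_smul_measure, gaussianReal_halfLine, posTruncMean,
    partialMoment]
  simp only [if_true, halfLine, pow_one]
  rw [gaussianReal_of_var_ne_zero _ one_ne_zero,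
    setIntegral_withDensity_eq_setIntegral_toReal_smul (by fun_prop)
      (ae_of_all _ fun _ => gaussianPDF_lt_top) _ measurableSet_Ioi, ENNReal.toReal_inv,
    ENNReal.toReal_ofReal (stdNormalCDF_pos t).le, smul_eq_mul, div_eq_inv_mul]
  congr 1
  refine integral_congr_ae (ae_of_all _ fun z => ?_)
  simp only [gaussianPDF, gaussianPDFReal_one_eq, smul_eq_mul,
    ENNReal.toReal_ofReal (stdNormalPDF_pos _).le]
  ring

lemma integrable_truncQuantile (a : Bool) (t : ℝ) : Integrable (truncQuantile a t) unif := by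
  have hm : Measurable (truncQuantile a t) :=
    (measurable_truncQuantile a).comp measurable_prodMk_left
  have h : Integrable (fun z : ℝ => z) (truncNormal t a) := by
    refine Integrable.smul_measure ?_
      (ENNReal.inv_ne_top.2 (gaussianReal_halfLine_ne_zero t a))
    exact ((memLp_id_gaussianReal (μ := t) (v := 1) 1).integrable (by simp)).integrableOn
  rw [← map_truncQuantile] at h
  exact (integrable_map_measure (by fun_prop) hm.aemeasurable).1 h

/-- The mean of `N(t, 1)` truncated to a half-line. -/
def truncMean (a : Bool) (t : ℝ) : ℝ := ∫ u, truncQuantile a t u ∂unif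

lemma truncMean_true (t : ℝ) : truncMean true t = posTruncMean t := by
  have hm : Measurable (truncQuantile true t) :=
    (measurable_truncQuantile true).comp measurable_prodMk_left
  rw [← integral_id_truncNormal_true, ← map_truncQuantile,
    integral_map hm.aemeasurable (by fun_prop), truncMean]

lemma truncMean_false (t : ℝ) : truncMean false t = -posTruncMean (-t) := by
  rw [← truncMean_true, truncMean, truncMean, ← integral_neg]
  rfl

lemma truncMean_sub (a : Bool) {s t : ℝ} (hst : s ≤ t) :
    0 ≤ truncMean a t - truncMean a s ∧ truncMean a t - truncMean a s ≤ t - s := by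
  have e : truncMean a t - truncMean a s = ∫ u, truncQuantile a t u - truncQuantile a s u ∂unif :=
    (integral_sub (integrable_truncQuantile a t) (integrable_truncQuantile a s)).symm
  have hae : ∀ᵐ u ∂unif, u ∈ Set.Ioo (0 : ℝ) 1 := ae_restrict_mem measurableSet_Ioo
  rw [e]
  refine ⟨integral_nonneg_of_ae ?_, ?_⟩
  · filter_upwards [hae] with u hu using (truncQuantile_sub a hu hst).1
  · calc ∫ u, truncQuantile a t u - truncQuantile a s u ∂unif ≤ ∫ _u, t - s ∂unif := by
          refine integral_mono_ae ((integrable_truncQuantile a t).sub (integrable_truncQuantile a s))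
            (integrable_const _) ?_
          filter_upwards [hae] with u hu using (truncQuantile_sub a hu hst).2
      _ = t - s := by simp

/-- The slope of the mean of the truncated normal distribution between two locations. -/
def truncSlope (a : Bool) (s t : ℝ) : ℝ := (truncMean a t - truncMean a s) / (t - s)

lemma truncSlope_comm (a : Bool) (s t : ℝ) : truncSlope a s t = truncSlope a t s := by
  rw [truncSlope, truncSlope, ← neg_sub (truncMean a s), ← neg_sub s t, neg_div_neg_eq]

/-- At s = t the slope is 0/0 = 0 and both sides vanish, so coinciding predictors need no separate
treatment later. -/
lemma truncSlope_mul (a : Bool) (s t : ℝ) :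
    truncSlope a s t * (t - s) = truncMean a t - truncMean a s := by
  rcases eq_or_ne s t with rfl | h
  · simp
  · exact div_mul_cancel₀ _ (sub_ne_zero.2 h.symm)

lemma truncSlope_mem (a : Bool) (s t : ℝ) : truncSlope a s t ∈ Set.Icc (0 : ℝ) 1 := by
  wlog h : s ≤ t generalizing s t
  · rw [truncSlope_comm]; exact this t s (le_of_not_ge h)
  have := truncMean_sub a h
  exact ⟨div_nonneg this.1 (sub_nonneg.2 h), div_le_one_of_le₀ this.2 (sub_nonneg.2 h)⟩

/-- Reflection turns the slope for response 0 into a slope of the positive mean between -t and -s,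
so that `posTruncMean_sub_add_le` applies. -/
lemma truncSlope_add_le (s t : ℝ) : truncSlope true s t + truncSlope false s t ≤ 7 / 4 := by
  wlog h : s ≤ t generalizing s t
  · rw [truncSlope_comm, truncSlope_comm false]; exact this t s (le_of_not_ge h)
  have := posTruncMean_sub_add_le h
  rw [truncSlope, truncSlope, ← add_div, truncMean_true, truncMean_true, truncMean_false,
    truncMean_false]
  refine div_le_of_le_mul₀ (sub_nonneg.2 h) (by norm_num) ?_
  linarith

end TruncatedQuantile

/-! ### Whitening by the square root of Σ -/

section LinearAlgebra

variable {n p : ℕ} {X : Matrix (Fin n) (Fin p) ℝ} {Q : Matrix (Fin p) (Fin p) ℝ}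

lemma posSemidef_of_posDef_or_zero (hQ : Q.PosDef ∨ Q = 0) : Q.PosSemidef := by
  rcases hQ with h | rfl
  · exact h.posSemidef
  · exact Matrix.PosSemidef.zero

lemma posDef_precision (hQ : Q.PosSemidef) (hdet : IsUnit (precision X Q).det) :
    (precision X Q).PosDef := by
  have h : (precision X Q).PosSemidef := by
    have := (Matrix.posSemidef_conjTranspose_mul_self X).add hQ
    rwa [Matrix.conjTranspose_eq_transpose_of_trivial] at this
  exact h.posDef_iff_isUnit.2 ((Matrix.isUnit_iff_isUnit_det _).2 hdet)

/-- The symmetric square root `Σ^{-1/2}`. -/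
def covSqrt (X : Matrix (Fin n) (Fin p) ℝ) (Q : Matrix (Fin p) (Fin p) ℝ) :
    Matrix (Fin p) (Fin p) ℝ :=
  CFC.sqrt (precision X Q)⁻¹

lemma covSqrt_mul_self (h : (precision X Q).PosDef) :
    covSqrt X Q * covSqrt X Q = (precision X Q)⁻¹ :=
  CFC.sqrt_mul_sqrt_self _ h.inv.posSemidef.nonneg

lemma covSqrt_transpose : (covSqrt X Q)ᵀ = covSqrt X Q := by
  have h := (Matrix.nonneg_iff_posSemidef.1 (CFC.sqrt_nonneg (precision X Q)⁻¹)).isHermitian.eq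
  rwa [Matrix.conjTranspose_eq_transpose_of_trivial] at h

lemma isUnit_det_covSqrt (h : (precision X Q).PosDef) : IsUnit (covSqrt X Q).det := by
  have h1 : IsUnit ((precision X Q)⁻¹).det := (Matrix.isUnit_iff_isUnit_det _).1 h.inv.isUnit
  rw [← covSqrt_mul_self h, Matrix.det_mul] at h1
  exact isUnit_of_mul_isUnit_left h1

lemma covSqrt_inv_mul_self (h : (precision X Q).PosDef) :
    (covSqrt X Q)⁻¹ * (covSqrt X Q)⁻¹ = precision X Q := by
  rw [← Matrix.mul_inv_rev, covSqrt_mul_self h,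
    Matrix.nonsing_inv_nonsing_inv _ ((Matrix.isUnit_iff_isUnit_det _).1 h.isUnit)]

/-- The linear map `Σ^{1/2}`. -/
def whiten (X : Matrix (Fin n) (Fin p) ℝ) (Q : Matrix (Fin p) (Fin p) ℝ) :
    EuclideanSpace ℝ (Fin p) →L[ℝ] EuclideanSpace ℝ (Fin p) :=
  Matrix.toEuclideanCLM (𝕜 := ℝ) (covSqrt X Q)⁻¹

/-- The linear map `Σ^{-1/2}`. -/
def unwhiten (X : Matrix (Fin n) (Fin p) ℝ) (Q : Matrix (Fin p) (Fin p) ℝ) :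
    EuclideanSpace ℝ (Fin p) →L[ℝ] EuclideanSpace ℝ (Fin p) :=
  Matrix.toEuclideanCLM (𝕜 := ℝ) (covSqrt X Q)

lemma ofLp_whiten (x : EuclideanSpace ℝ (Fin p)) :
    (whiten X Q x).ofLp = (covSqrt X Q)⁻¹ *ᵥ x.ofLp := Matrix.ofLp_toEuclideanCLM _ _

lemma ofLp_unwhiten (x : EuclideanSpace ℝ (Fin p)) :
    (unwhiten X Q x).ofLp = covSqrt X Q *ᵥ x.ofLp := Matrix.ofLp_toEuclideanCLM _ _

lemma whiten_unwhiten (h : (precision X Q).PosDef) (x : EuclideanSpace ℝ (Fin p)) :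
    whiten X Q (unwhiten X Q x) = x := by
  apply WithLp.ofLp_injective
  rw [ofLp_whiten, ofLp_unwhiten, Matrix.mulVec_mulVec,
    Matrix.nonsing_inv_mul _ (isUnit_det_covSqrt h), Matrix.one_mulVec]

lemma unwhiten_whiten (h : (precision X Q).PosDef) (x : EuclideanSpace ℝ (Fin p)) :
    unwhiten X Q (whiten X Q x) = x := by
  apply WithLp.ofLp_injective
  rw [ofLp_unwhiten, ofLp_whiten, Matrix.mulVec_mulVec,
    Matrix.mul_nonsing_inv _ (isUnit_det_covSqrt h), Matrix.one_mulVec]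

lemma norm_sq_eq_dotProduct (x : EuclideanSpace ℝ (Fin p)) : ‖x‖ ^ 2 = x.ofLp ⬝ᵥ x.ofLp := by
  rw [EuclideanSpace.real_norm_sq_eq, dotProduct]
  exact Finset.sum_congr rfl fun i _ => sq _

lemma norm_whiten_sq (h : (precision X Q).PosDef) (x : EuclideanSpace ℝ (Fin p)) :
    ‖whiten X Q x‖ ^ 2 = x.ofLp ⬝ᵥ (precision X Q *ᵥ x.ofLp) := by
  have ht : ((covSqrt X Q)⁻¹)ᵀ = (covSqrt X Q)⁻¹ := by
    rw [Matrix.transpose_nonsing_inv, covSqrt_transpose]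
  rw [norm_sq_eq_dotProduct, ofLp_whiten, ← covSqrt_inv_mul_self h, ← Matrix.mulVec_mulVec,
    Matrix.dotProduct_mulVec (x.ofLp), ← Matrix.mulVec_transpose, ht]

lemma psi_eq_norm (h : (precision X Q).PosDef) (b b' : EuclideanSpace ℝ (Fin p)) :
    psi X Q b b' = ‖whiten X Q (b - b')‖ := by
  rw [psi, ← norm_whiten_sq h, Real.sqrt_sq (norm_nonneg _)]

lemma measurable_psi (h : (precision X Q).PosDef) : Measurable (Function.uncurry (psi X Q)) := by
  have : Function.uncurry (psi X Q) = fun w => ‖whiten X Q (w.1 - w.2)‖ :=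
    funext fun w => psi_eq_norm h _ _
  rw [this]
  fun_prop

end LinearAlgebra

/-! ### Gaussian densities and Lipschitz dependence on the mean -/

section Gaussian

open WithLp

/-- The product of measures with densities has the product density. -/
lemma pi_withDensity_ofReal {ι : Type*} [Fintype ι] (m : ι → Measure ℝ) [∀ i, SigmaFinite (m i)]
    {g : ι → ℝ → ℝ} (h0 : ∀ i x, 0 ≤ g i x)
    (hi : ∀ i, Integrable (g i) (m i)) :
    Measure.pi (fun i => (m i).withDensity fun x => ENNReal.ofReal (g i x)) =
      (Measure.pi m).withDensity fun x => ENNReal.ofReal (∏ i, g i (x i)) := by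
  have (i : ι) : IsFiniteMeasure ((m i).withDensity fun x => ENNReal.ofReal (g i x)) :=
    isFiniteMeasure_withDensity_ofReal (hi i).2
  refine Measure.pi_eq fun s hs => ?_
  rw [withDensity_apply _ (MeasurableSet.univ_pi hs), Measure.restrict_pi_pi,
    ← ofReal_integral_eq_lintegral_ofReal]
  · rw [integral_fintype_prod_eq_prod, ENNReal.ofReal_prod_of_nonneg
      fun i _ => integral_nonneg (h0 i)]
    refine Finset.prod_congr rfl fun i _ => ?_
    rw [withDensity_apply _ (hs i), ofReal_integral_eq_lintegral_ofReal (hi i).integrableOn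
      (ae_of_all _ (h0 i))]
  · exact Integrable.fintype_prod fun i => (hi i).integrableOn
  · exact ae_of_all _ fun x => Finset.prod_nonneg fun i _ => h0 i _

lemma stdGaussian_eq_withDensity (p : ℕ) :
    stdGaussian (EuclideanSpace ℝ (Fin p)) = volume.withDensity fun x =>
      ENNReal.ofReal ((√(2 * Real.pi))⁻¹ ^ p * Real.exp (-‖x‖ ^ 2 / 2)) := by
  have hpi : Measure.pi (fun _ : Fin p => gaussianReal 0 1) =
      (volume : Measure (Fin p → ℝ)).withDensity fun x =>
        ENNReal.ofReal (∏ i, stdNormalPDF (x i)) := by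
    rw [volume_pi, ← pi_withDensity_ofReal]
    · rw [gaussianReal_of_var_ne_zero _ one_ne_zero]; rfl
    · exact fun _ x => (stdNormalPDF_pos x).le
    · exact fun _ => integrable_gaussianPDFReal 0 1
  have hprod (x : Fin p → ℝ) : ∏ i, stdNormalPDF (x i) =
      (√(2 * Real.pi))⁻¹ ^ p * Real.exp (-‖toLp 2 x‖ ^ 2 / 2) := by
    simp only [stdNormalPDF_eq, Finset.prod_mul_distrib, Finset.prod_const, Finset.card_univ,
      Fintype.card_fin, ← Real.exp_sum, EuclideanSpace.real_norm_sq_eq, ← Finset.sum_div,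
      Finset.sum_neg_distrib]
  rw [← map_pi_eq_stdGaussian, hpi]
  ext A hA
  have hm : Measurable (toLp 2 : (Fin p → ℝ) → _) := by fun_prop
  rw [Measure.map_apply hm hA, withDensity_apply _ (hm hA), withDensity_apply _ hA]
  simp_rw [hprod]
  exact (PiLp.volume_preserving_toLp (Fin p)).setLIntegral_comp_preimage hA (by fun_prop)
    (f := fun x => ENNReal.ofReal ((√(2 * Real.pi))⁻¹ ^ p * Real.exp (-‖x‖ ^ 2 / 2)))

variable {n p : ℕ} {X : Matrix (Fin n) (Fin p) ℝ} {Q : Matrix (Fin p) (Fin p) ℝ}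

lemma multivariateGaussian_eq_map (m : EuclideanSpace ℝ (Fin p)) :
    multivariateGaussian m (precision X Q)⁻¹ =
      (stdGaussian (EuclideanSpace ℝ (Fin p))).map fun x => m + unwhiten X Q x := rfl

lemma det_unwhiten_ne_zero (h : (precision X Q).PosDef) :
    LinearMap.det (unwhiten X Q : EuclideanSpace ℝ (Fin p) →ₗ[ℝ] _) ≠ 0 := by
  refine fun h0 => ?_
  have hinj : Function.Injective (unwhiten X Q) := fun x y hxy => by
    rw [← whiten_unwhiten h x, hxy, whiten_unwhiten h]
  have := LinearMap.bot_lt_ker_of_det_eq_zero h0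
  rw [LinearMap.ker_eq_bot.2 hinj] at this
  exact lt_irrefl _ this

/-- Change of variables under Σ^{-1/2}. The constant stays implicit, as only its independence of m
and its being neither 0 nor ∞ matter for identifying the conditional law. -/
lemma multivariateGaussian_eq_withDensity (h : (precision X Q).PosDef) :
    ∃ C : ℝ≥0∞, C ≠ 0 ∧ C ≠ ∞ ∧ ∀ m, multivariateGaussian m (precision X Q)⁻¹ =
      C • volume.withDensity fun b => ENNReal.ofReal (Real.exp (-psi X Q b m ^ 2 / 2)) := by
  set D := LinearMap.det (unwhiten X Q : EuclideanSpace ℝ (Fin p) →ₗ[ℝ] _) with hD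
  have hD0 : D ≠ 0 := det_unwhiten_ne_zero h
  set c : ℝ := (√(2 * Real.pi))⁻¹ ^ p with hc
  have hc0 : 0 < c := by positivity
  refine ⟨ENNReal.ofReal |D⁻¹| * ENNReal.ofReal c, ?_, by finiteness, fun m => ?_⟩
  · simp [hc0, hD0]
  ext A hA
  have hm : Measurable fun x => m + unwhiten X Q x := by fun_prop
  rw [multivariateGaussian_eq_map, Measure.map_apply hm hA, stdGaussian_eq_withDensity,
    withDensity_apply _ (hm hA), Measure.smul_apply, withDensity_apply _ hA, smul_eq_mul, mul_assoc,
    ← lintegral_const_mul' _ _ ENNReal.ofReal_ne_top]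
  set H : EuclideanSpace ℝ (Fin p) → ℝ≥0∞ := A.indicator fun b =>
    ENNReal.ofReal c * ENNReal.ofReal (Real.exp (-‖whiten X Q (b - m)‖ ^ 2 / 2)) with hH
  have hHm : Measurable H := Measurable.indicator (by fun_prop) hA
  have e1 : ∫⁻ x in (fun x => m + unwhiten X Q x) ⁻¹' A,
      ENNReal.ofReal (c * Real.exp (-‖x‖ ^ 2 / 2)) = ∫⁻ x, H (m + unwhiten X Q x) := by
    rw [← lintegral_indicator (hm hA)]
    refine lintegral_congr fun x => ?_
    simp only [hH, Set.indicator, Set.mem_preimage]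
    congr 1
    rw [add_sub_cancel_left, whiten_unwhiten h, ENNReal.ofReal_mul hc0.le]
  have e2 : ∫⁻ b in A, ENNReal.ofReal c * ENNReal.ofReal (Real.exp (-psi X Q b m ^ 2 / 2)) =
      ∫⁻ b, H b := by
    rw [hH, lintegral_indicator hA]
    simp_rw [psi_eq_norm h]
  rw [e1, e2]
  have hmap := Measure.map_linearMap_addHaar_eq_smul_addHaar
    (volume : Measure (EuclideanSpace ℝ (Fin p))) hD0
  have hmu : Measurable (unwhiten X Q) := by fun_prop
  rw [ContinuousLinearMap.coe_coe] at hmap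
  calc ∫⁻ x, H (m + unwhiten X Q x)
      = ∫⁻ b, H (m + b) ∂(volume.map (unwhiten X Q)) :=
        (lintegral_map (hHm.comp (measurable_const_add m)) hmu).symm
    _ = ENNReal.ofReal |D⁻¹| * ∫⁻ b, H (m + b) := by rw [hmap, lintegral_smul_measure, smul_eq_mul]
    _ = ENNReal.ofReal |D⁻¹| * ∫⁻ b, H b := by rw [lintegral_add_left_eq_self]

/-- Comparison with (1 + ‖x‖)^{-(d+1)}, integrable in dimension d: one term of the exponential
series bounds (1 + ‖x‖)^{k+d+1} by a multiple of exp (c ‖x‖). -/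
lemma integrable_pow_norm_mul_exp_neg {E : Type*} [NormedAddCommGroup E] [NormedSpace ℝ E]
    [FiniteDimensional ℝ E] [MeasurableSpace E] [BorelSpace E] (μ : Measure E)
    [μ.IsAddHaarMeasure] (k : ℕ) {c : ℝ} (hc : 0 < c) :
    Integrable (fun x => ‖x‖ ^ k * Real.exp (-(c * ‖x‖))) μ := by
  set d := Module.finrank ℝ E
  set N := k + (d + 1)
  have hI : Integrable (fun x : E => (1 + ‖x‖) ^ (-((d : ℝ) + 1))) μ :=
    integrable_one_add_norm (by simp [d])
  refine (hI.const_mul (N.factorial / c ^ N * Real.exp c)).mono'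
    (by fun_prop) (ae_of_all _ fun x => ?_)
  have hs : 0 < 1 + ‖x‖ := by positivity
  rw [Real.norm_of_nonneg (by positivity), Real.rpow_neg hs.le,
    show ((d : ℝ) + 1) = ((d + 1 : ℕ) : ℝ) by push_cast; ring, Real.rpow_natCast,
    ← div_eq_mul_inv, le_div_iff₀ (by positivity)]
  have h1 := Real.pow_div_factorial_le_exp (c * (1 + ‖x‖)) (by positivity) N
  rw [div_le_iff₀ (by positivity), mul_pow] at h1
  have h2 : (1 + ‖x‖) ^ N ≤ N.factorial / c ^ N * Real.exp (c * (1 + ‖x‖)) := by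
    rw [div_mul_eq_mul_div, le_div_iff₀ (by positivity)]
    linarith
  have h3 : ‖x‖ ^ k ≤ (1 + ‖x‖) ^ k := by gcongr; linarith
  calc ‖x‖ ^ k * Real.exp (-(c * ‖x‖)) * (1 + ‖x‖) ^ (d + 1)
      ≤ (1 + ‖x‖) ^ k * Real.exp (-(c * ‖x‖)) * (1 + ‖x‖) ^ (d + 1) := by gcongr
    _ = (1 + ‖x‖) ^ N * Real.exp (-(c * ‖x‖)) := by simp only [N, pow_add]; ring
    _ ≤ N.factorial / c ^ N * Real.exp (c * (1 + ‖x‖)) * Real.exp (-(c * ‖x‖)) := by gcongr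
    _ = N.factorial / c ^ N * Real.exp c := by
      rw [mul_assoc, ← Real.exp_add]
      ring_nf

lemma abs_exp_neg_sub_le (a b : ℝ) :
    |Real.exp (-a) - Real.exp (-b)| ≤ |a - b| * (Real.exp (-a) + Real.exp (-b)) := by
  wlog h : a ≤ b generalizing a b
  · rw [abs_sub_comm, abs_sub_comm a, add_comm]
    exact this b a (le_of_not_ge h)
  rw [abs_of_nonneg (sub_nonneg.2 (Real.exp_le_exp.2 (by linarith))), abs_of_nonpos (by linarith)]
  have h1 : Real.exp (-b) = Real.exp (-a) * Real.exp (a - b) := by rw [← Real.exp_add]; ring_nf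
  have h2 := Real.add_one_le_exp (a - b)
  have := Real.exp_pos (-a)
  have := Real.exp_pos (-b)
  nlinarith

/-- Translates of the standard Gaussian measure depend on the translation in a Lipschitz way in
total variation. -/
lemma stdGaussian_translate_lipschitz (p : ℕ) : ∃ L : ℝ≥0, ∀ (a a' : EuclideanSpace ℝ (Fin p))
    (B : Set (EuclideanSpace ℝ (Fin p))), MeasurableSet B →
    |((stdGaussian (EuclideanSpace ℝ (Fin p))).map fun x => a + x).real B -
      ((stdGaussian (EuclideanSpace ℝ (Fin p))).map fun x => a' + x).real B| ≤ L * ‖a - a'‖ := by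
  set E := EuclideanSpace ℝ (Fin p)
  set c : ℝ := (√(2 * Real.pi))⁻¹ ^ p with hc
  have hc0 : 0 < c := by positivity
  set f : E → ℝ := fun x => c * Real.exp (-(‖x‖ ^ 2 / 2)) with hf
  have hf0 (x : E) : 0 ≤ f x := by positivity
  have hbound (x : E) : f x ≤ c * Real.exp (1 / 2) * Real.exp (-(1 * ‖x‖)) := by
    rw [mul_assoc, ← Real.exp_add]
    refine mul_le_mul_of_nonneg_left (Real.exp_le_exp.2 ?_) hc0.le
    nlinarith [sq_nonneg (‖x‖ - 1)]
  have hfi : Integrable f := by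
    refine ((integrable_pow_norm_mul_exp_neg (volume : Measure E) 0 one_pos).const_mul
      (c * Real.exp (1 / 2))).mono' (by fun_prop) (ae_of_all _ fun x => ?_)
    rw [Real.norm_of_nonneg (hf0 x), pow_zero, one_mul]
    exact hbound x
  have hgi : Integrable fun x => (2 * ‖x‖ + 1) * f x := by
    have h1 : Integrable fun x => ‖x‖ * f x := by
      refine ((integrable_pow_norm_mul_exp_neg (volume : Measure E) 1 one_pos).const_mul
        (c * Real.exp (1 / 2))).mono' (by fun_prop) (ae_of_all _ fun x => ?_)
      rw [Real.norm_of_nonneg (by positivity), pow_one]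
      calc ‖x‖ * f x ≤ ‖x‖ * (c * Real.exp (1 / 2) * Real.exp (-(1 * ‖x‖))) := by
            gcongr; exact hbound x
        _ = _ := by ring
    refine ((h1.const_mul 2).add hfi).congr (ae_of_all _ fun x => ?_)
    simp only [Pi.add_apply]; ring
  set J := ∫ x, (2 * ‖x‖ + 1) * f x with hJ
  have hmap (a : E) (B : Set E) (hB : MeasurableSet B) :
      ((stdGaussian E).map fun x => a + x).real B = ∫ x in B, f (x - a) := by
    have hm : Measurable fun x => a + x := by fun_prop
    rw [Measure.real, Measure.map_apply hm hB, stdGaussian_eq_withDensity,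
      withDensity_apply _ (hm hB),
      ← ofReal_integral_eq_lintegral_ofReal _ (ae_of_all _ fun x => by positivity),
      ENNReal.toReal_ofReal (integral_nonneg fun x => by positivity),
      ← integral_indicator (hm hB), ← integral_indicator hB,
      ← integral_add_left_eq_self (B.indicator fun x => f (x - a)) a]
    · refine integral_congr_ae (ae_of_all _ fun x => ?_)
      simp only [Set.indicator, add_sub_cancel_left, hf, ← hc, neg_div]
      rfl
    · simp only [neg_div]
      exact hfi.integrableOn
  have hle (a a' : E) (B : Set E) (hB : MeasurableSet B) :
      |((stdGaussian E).map fun x => a + x).real B -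
        ((stdGaussian E).map fun x => a' + x).real B| ≤ 1 := by
    have h1 : IsProbabilityMeasure ((stdGaussian E).map fun x => a + x) :=
      Measure.isProbabilityMeasure_map (by fun_prop)
    have h2 : IsProbabilityMeasure ((stdGaussian E).map fun x => a' + x) :=
      Measure.isProbabilityMeasure_map (by fun_prop)
    have h3 := measureReal_le_one (μ := (stdGaussian E).map fun x => a + x) (s := B)
    have h4 := measureReal_le_one (μ := (stdGaussian E).map fun x => a' + x) (s := B)
    rw [abs_le]
    constructor <;> linarith [measureReal_nonneg (μ := (stdGaussian E).map fun x => a + x) (s := B),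
      measureReal_nonneg (μ := (stdGaussian E).map fun x => a' + x) (s := B)]
  -- The 1 handles shifts of length at least 1, where the trivial bound suffices; J is the constant
  -- for shorter shifts.
  refine ⟨Real.toNNReal (max 1 J), fun a a' B hB => ?_⟩
  rw [Real.coe_toNNReal _ (by positivity)]
  rcases le_or_gt 1 ‖a - a'‖ with h1 | h1
  · refine (hle a a' B hB).trans ?_
    nlinarith [le_max_left 1 J]
  · rw [hmap a B hB, hmap a' B hB, ← integral_sub (hfi.comp_sub_right a).integrableOn
      (hfi.comp_sub_right a').integrableOn]
    have hpt (x : E) : |f (x - a) - f (x - a')| ≤ ‖a - a'‖ / 2 *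
        ((2 * ‖x - a‖ + 1) * f (x - a) + (2 * ‖x - a'‖ + 1) * f (x - a')) := by
      have e1 : |f (x - a) - f (x - a')| = c * |Real.exp (-(‖x - a‖ ^ 2 / 2)) -
          Real.exp (-(‖x - a'‖ ^ 2 / 2))| := by
        rw [hf, ← mul_sub, abs_mul, abs_of_pos hc0]
      have e2 : |‖x - a‖ ^ 2 / 2 - ‖x - a'‖ ^ 2 / 2| ≤ ‖a - a'‖ / 2 * (‖x - a‖ + ‖x - a'‖) := by
        have e3 : ‖x - a‖ ^ 2 / 2 - ‖x - a'‖ ^ 2 / 2 =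
            (‖x - a‖ - ‖x - a'‖) * ((‖x - a‖ + ‖x - a'‖) / 2) := by ring
        have e4 : |‖x - a‖ - ‖x - a'‖| ≤ ‖a - a'‖ := by
          refine (abs_norm_sub_norm_le _ _).trans ?_
          rw [sub_sub_sub_cancel_left, norm_sub_rev]
        rw [e3, abs_mul, abs_of_nonneg (show 0 ≤ (‖x - a‖ + ‖x - a'‖) / 2 by positivity)]
        calc _ ≤ ‖a - a'‖ * ((‖x - a‖ + ‖x - a'‖) / 2) := by gcongr
          _ = _ := by ring
      -- For a shift shorter than 1 the weight ‖x - a‖ + ‖x - a'‖ can be expressed through either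
      -- centre alone. Each density is paired with its own centre, and translation invariance then
      -- gives J twice.
      have e5 : ‖x - a'‖ ≤ ‖x - a‖ + 1 := by
        have : x - a' = (x - a) + (a - a') := by abel
        rw [this]
        exact (norm_add_le _ _).trans (by linarith)
      have e6 : ‖x - a‖ ≤ ‖x - a'‖ + 1 := by
        have : x - a = (x - a') - (a - a') := by abel
        rw [this]
        exact (norm_sub_le _ _).trans (by linarith)
      rw [e1]
      calc _ ≤ c * (|‖x - a‖ ^ 2 / 2 - ‖x - a'‖ ^ 2 / 2| *
            (Real.exp (-(‖x - a‖ ^ 2 / 2)) + Real.exp (-(‖x - a'‖ ^ 2 / 2)))) := by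
            gcongr; exact abs_exp_neg_sub_le _ _
        _ ≤ c * (‖a - a'‖ / 2 * (‖x - a‖ + ‖x - a'‖) *
            (Real.exp (-(‖x - a‖ ^ 2 / 2)) + Real.exp (-(‖x - a'‖ ^ 2 / 2)))) := by gcongr
        _ = ‖a - a'‖ / 2 * ((‖x - a‖ + ‖x - a'‖) * f (x - a) +
            (‖x - a‖ + ‖x - a'‖) * f (x - a')) := by simp only [hf]; ring
        _ ≤ _ := by
          exact mul_le_mul_of_nonneg_left (add_le_add
            (mul_le_mul_of_nonneg_right (by linarith) (hf0 _))
            (mul_le_mul_of_nonneg_right (by linarith) (hf0 _))) (by positivity)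
    have hi1 := hgi.comp_sub_right a
    have hi2 := hgi.comp_sub_right a'
    calc |∫ x in B, f (x - a) - f (x - a')|
        ≤ ∫ x in B, |f (x - a) - f (x - a')| := abs_integral_le_integral_abs
      _ ≤ ∫ x, |f (x - a) - f (x - a')| := setIntegral_le_integral
          ((hfi.comp_sub_right a).sub (hfi.comp_sub_right a')).abs
          (ae_of_all _ fun x => abs_nonneg _)
      _ ≤ ∫ x, ‖a - a'‖ / 2 *
        ((2 * ‖x - a‖ + 1) * f (x - a) + (2 * ‖x - a'‖ + 1) * f (x - a')) :=
          integral_mono ((hfi.comp_sub_right a).sub (hfi.comp_sub_right a')).abs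
            ((hi1.add hi2).const_mul _) hpt
      _ = ‖a - a'‖ / 2 * (J + J) := by
          rw [integral_const_mul, integral_add hi1 hi2,
            integral_sub_right_eq_self (fun x => (2 * ‖x‖ + 1) * f x) a,
            integral_sub_right_eq_self (fun x => (2 * ‖x‖ + 1) * f x) a']
      _ = J * ‖a - a'‖ := by ring
      _ ≤ _ := by gcongr; exact le_max_right _ _

/-- N(m, Σ⁻¹) is the image under Σ^{-1/2} of the standard Gaussian translated by Σ^{1/2} m, and ψ is
the Euclidean distance between these translations. -/
lemma multivariateGaussian_lipschitz (h : (precision X Q).PosDef) : ∃ L : ℝ≥0,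
    ∀ (m m' : EuclideanSpace ℝ (Fin p)) (A : Set (EuclideanSpace ℝ (Fin p))), MeasurableSet A →
      |(multivariateGaussian m (precision X Q)⁻¹).real A -
        (multivariateGaussian m' (precision X Q)⁻¹).real A| ≤ L * psi X Q m m' := by
  obtain ⟨L, hL⟩ := stdGaussian_translate_lipschitz p
  refine ⟨L, fun m m' A hA => ?_⟩
  have hu : Measurable (unwhiten X Q) := by fun_prop
  have key (m : EuclideanSpace ℝ (Fin p)) : (multivariateGaussian m (precision X Q)⁻¹).real A =
      ((stdGaussian (EuclideanSpace ℝ (Fin p))).map fun x => whiten X Q m + x).real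
        (unwhiten X Q ⁻¹' A) := by
    have hm : Measurable fun x => whiten X Q m + x := by fun_prop
    rw [multivariateGaussian_eq_map, Measure.real, Measure.real,
      Measure.map_apply (by fun_prop) hA, Measure.map_apply hm (hu hA), ← Set.preimage_comp]
    congr 3
    ext x : 1
    simp only [Function.comp_apply, map_add, unwhiten_whiten h]
  rw [key, key, psi_eq_norm h, map_sub]
  exact hL _ _ _ (hu hA)

end Gaussian

/-! ### Invariance of the posterior under the Gibbs sampler -/

section Invariance

/-- A two-block Gibbs sampler leaves the marginal of the joint density invariant. -/
lemma withDensity_bind_comp {E Z : Type*} [MeasurableSpace E] [MeasurableSpace Z]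
    {lE : Measure E} {lZ : Measure Z} [SigmaFinite lE] [SigmaFinite lZ] {w : E → ℝ≥0∞}
    (hw : Measurable w) {L : Kernel E Z} {U : Kernel Z E} [IsMarkovKernel L] [IsMarkovKernel U]
    {j : E → Z → ℝ≥0∞} (hj : Measurable (Function.uncurry j))
    (h1 : ∀ b, w b • L b = lZ.withDensity (j b)) (g : Z → ℝ≥0∞)
    (h2 : ∀ z, lE.withDensity (fun b => j b z) = g z • U z) :
    (lE.withDensity w).bind (U ∘ₖ L) = lE.withDensity w := by
  have hjb (b : E) : Measurable (j b) := hj.comp measurable_prodMk_left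
  have hjz (z : Z) : Measurable fun b => j b z := hj.comp measurable_prodMk_right
  -- Taking total masses in the two disintegrations of j shows that w and g are its marginal
  -- densities.
  have hw1 (b : E) : w b = ∫⁻ z, j b z ∂lZ := by
    have := congrArg (fun m => m Set.univ) (h1 b)
    simpa using this
  have hg1 (z : Z) : g z = ∫⁻ b, j b z ∂lE := by
    have := congrArg (fun m => m Set.univ) (h2 z)
    simpa using this.symm
  ext A hA
  have hUA : Measurable fun z => U z A := Kernel.measurable_coe U hA
  rw [Measure.bind_apply hA (Kernel.measurable _).aemeasurable,
    lintegral_withDensity_eq_lintegral_mul _ hw (Kernel.measurable_coe _ hA), withDensity_apply _ hA]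
  calc ∫⁻ b, (w * fun b => (U ∘ₖ L) b A) b ∂lE
      = ∫⁻ b, ∫⁻ z, U z A * j b z ∂lZ ∂lE := by
        refine lintegral_congr fun b => ?_
        rw [Pi.mul_apply, Kernel.comp_apply' _ _ _ hA, ← smul_eq_mul, ← lintegral_smul_measure, h1,
          lintegral_withDensity_eq_lintegral_mul _ (hjb b) hUA]
        refine lintegral_congr fun z => ?_
        rw [Pi.mul_apply, mul_comm]
    _ = ∫⁻ z, ∫⁻ b, U z A * j b z ∂lE ∂lZ :=
        lintegral_lintegral_swap ((hUA.comp measurable_snd).mul hj).aemeasurable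
    _ = ∫⁻ z, ∫⁻ b in A, j b z ∂lE ∂lZ := by
        refine lintegral_congr fun z => ?_
        rw [lintegral_const_mul _ (hjz z), ← hg1, ← withDensity_apply _ hA, h2 z,
          Measure.smul_apply, smul_eq_mul, mul_comm]
    _ = ∫⁻ b in A, ∫⁻ z, j b z ∂lZ ∂lE :=
        lintegral_lintegral_swap (hj.comp measurable_swap).aemeasurable
    _ = ∫⁻ b in A, w b ∂lE := lintegral_congr fun b => (hw1 b).symm

variable {n p : ℕ} {X : Matrix (Fin n) (Fin p) ℝ} {Q : Matrix (Fin p) (Fin p) ℝ}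
  {v : EuclideanSpace ℝ (Fin p)} {y : Fin n → Bool}

instance : IsMarkovKernel (latentKernel X y) :=
  ⟨fun β => by
    change IsProbabilityMeasure (Measure.pi fun i => truncNormal (linPred X β i) (y i))
    infer_instance⟩

instance : IsMarkovKernel (updateKernel X Q v) :=
  ⟨fun z => by
    change IsProbabilityMeasure (multivariateGaussian (updateMean X Q v z) (precision X Q)⁻¹)
    infer_instance⟩

instance : IsMarkovKernel (acKernel X Q v y) := by
  unfold acKernel; infer_instance

/-- The likelihood of a single response. -/
def responseProb (a : Bool) (t : ℝ) : ℝ := if a then stdNormalCDF t else 1 - stdNormalCDF t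

lemma responseProb_pos (a : Bool) (t : ℝ) : 0 < responseProb a t := by
  cases a
  · simpa [responseProb] using stdNormalCDF_lt_one t
  · simpa [responseProb] using stdNormalCDF_pos t

lemma measurable_responseProb (a : Bool) : Measurable (responseProb a) := by
  have := continuous_stdNormalCDF.measurable
  cases a
  · exact measurable_const.sub this
  · exact this

lemma measurable_linPred (i : Fin n) : Measurable fun β => linPred X β i := by
  unfold linPred Matrix.mulVec dotProduct
  fun_prop

lemma measurable_posteriorWeight : Measurable (posteriorWeight X Q v y) := by
  unfold posteriorWeight
  refine Measurable.mul (Finset.measurable_prod _ fun i _ =>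
    (measurable_responseProb (y i)).comp (measurable_linPred i)) ?_
  have : Continuous fun β : EuclideanSpace ℝ (Fin p) =>
      Real.exp (-(1 / 2) * ((β - v).ofLp ⬝ᵥ (Q *ᵥ (β - v).ofLp))) := by
    fun_prop
  exact this.measurable

lemma posteriorWeight_pos (β : EuclideanSpace ℝ (Fin p)) : 0 < posteriorWeight X Q v y β :=
  mul_pos (Finset.prod_pos fun i _ => responseProb_pos (y i) _) (Real.exp_pos _)

lemma truncNormal_eq_withDensity (t : ℝ) (a : Bool) :
    truncNormal t a = (volume.restrict (halfLine a)).withDensity fun z =>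
      ENNReal.ofReal ((responseProb a t)⁻¹ * stdNormalPDF (z - t)) := by
  have h0 := responseProb_pos a t
  rw [truncNormal, ProbabilityTheory.cond, gaussianReal_halfLine,
    gaussianReal_of_var_ne_zero _ one_ne_zero, restrict_withDensity (measurableSet_halfLine a)]
  change (ENNReal.ofReal (responseProb a t))⁻¹ • _ = _
  rw [← ENNReal.ofReal_inv_of_pos h0, ← withDensity_smul' _ _ ENNReal.ofReal_ne_top]
  congr 1
  ext z
  rw [Pi.smul_apply, smul_eq_mul, gaussianPDF, gaussianPDFReal_one_eq,
    ENNReal.ofReal_mul (inv_nonneg.2 h0.le)]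

/-- The unnormalized joint density of the coefficient and the latent variables. -/
def jointWeight (X : Matrix (Fin n) (Fin p) ℝ) (Q : Matrix (Fin p) (Fin p) ℝ)
    (v β : EuclideanSpace ℝ (Fin p)) (z : Fin n → ℝ) : ℝ :=
  (∏ i, stdNormalPDF (z i - linPred X β i)) *
    Real.exp (-(1 / 2) * ((β - v).ofLp ⬝ᵥ (Q *ᵥ (β - v).ofLp)))

lemma measurable_jointWeight : Measurable (Function.uncurry (jointWeight X Q v)) := by
  have h1 := continuous_stdNormalPDF
  have : Continuous (Function.uncurry (jointWeight X Q v)) := by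
    unfold Function.uncurry jointWeight linPred
    refine Continuous.mul (continuous_finsetProd _ fun i _ => h1.comp ?_) (by fun_prop)
    fun_prop
  exact this.measurable

/-- The normalizing constants of the truncated normals are exactly the likelihood factors of the
posterior weight, so they cancel. -/
lemma posteriorWeight_smul_latentKernel (β : EuclideanSpace ℝ (Fin p)) :
    ENNReal.ofReal (posteriorWeight X Q v y β) • latentKernel X y β =
      (Measure.pi fun i => volume.restrict (halfLine (y i))).withDensity fun z =>
        ENNReal.ofReal (jointWeight X Q v β z) := by
  have h1 : latentKernel X y β = (Measure.pi fun i => volume.restrict (halfLine (y i))).withDensity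
      fun z => ENNReal.ofReal (∏ i, ((responseProb (y i) (linPred X β i))⁻¹ *
        stdNormalPDF (z i - linPred X β i))) := by
    change Measure.pi (fun i => truncNormal (linPred X β i) (y i)) = _
    simp_rw [truncNormal_eq_withDensity]
    refine pi_withDensity_ofReal (fun i => volume.restrict (halfLine (y i)))
      (g := fun i z => (responseProb (y i) (linPred X β i))⁻¹ *
        stdNormalPDF (z - linPred X β i)) ?_ ?_
    · exact fun i z => mul_nonneg (inv_nonneg.2 (responseProb_pos _ _).le) (stdNormalPDF_pos _).le
    · refine fun i => Integrable.const_mul ?_ _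
      have := (integrable_pow_mul_stdNormalPDF (linPred X β i) 0)
      simp only [pow_zero, one_mul] at this
      exact this.restrict
  rw [h1, ← withDensity_smul' _ _ ENNReal.ofReal_ne_top]
  congr 1
  ext z
  rw [Pi.smul_apply, smul_eq_mul, ← ENNReal.ofReal_mul (posteriorWeight_pos β).le]
  congr 1
  have hne : ∏ i, responseProb (y i) (linPred X β i) ≠ 0 :=
    Finset.prod_ne_zero_iff.2 fun i _ => (responseProb_pos _ _).ne'
  change ((∏ i, responseProb (y i) (linPred X β i)) * _) * _ = _
  rw [Finset.prod_mul_distrib, Finset.prod_inv_distrib, jointWeight]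
  field_simp

/-- Completing the square. -/
lemma sum_sq_add_quadratic (hQ : Q.PosSemidef) (h : (precision X Q).PosDef) (z : Fin n → ℝ)
    (β : EuclideanSpace ℝ (Fin p)) :
    ∑ i, (z i - linPred X β i) ^ 2 + (β - v).ofLp ⬝ᵥ (Q *ᵥ (β - v).ofLp) =
      psi X Q β (updateMean X Q v z) ^ 2 + (z ⬝ᵥ z + v.ofLp ⬝ᵥ (Q *ᵥ v.ofLp) -
        (updateMean X Q v z).ofLp ⬝ᵥ (precision X Q *ᵥ (updateMean X Q v z).ofLp)) := by
  have hAm : precision X Q *ᵥ (updateMean X Q v z).ofLp = Xᵀ *ᵥ z + Q *ᵥ v.ofLp := by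
    rw [updateMean, Matrix.mulVec_mulVec, Matrix.mul_nonsing_inv _
      ((Matrix.isUnit_iff_isUnit_det _).1 h.isUnit), Matrix.one_mulVec]
  have hsymm {A : Matrix (Fin p) (Fin p) ℝ} (hA : A.IsHermitian) (a b : Fin p → ℝ) :
      a ⬝ᵥ (A *ᵥ b) = b ⬝ᵥ (A *ᵥ a) := by
    rw [Matrix.dotProduct_mulVec, ← Matrix.mulVec_transpose, dotProduct_comm]
    congr 2
  have hz : ∑ i, (z i - linPred X β i) ^ 2 =
      (z - X *ᵥ β.ofLp) ⬝ᵥ (z - X *ᵥ β.ofLp) := by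
    simp only [dotProduct, linPred, Pi.sub_apply, sq]
  have hXz (w : Fin n → ℝ) : (X *ᵥ β.ofLp) ⬝ᵥ w = β.ofLp ⬝ᵥ (Xᵀ *ᵥ w) := by
    rw [Matrix.dotProduct_mulVec, Matrix.vecMul_transpose]
  have hpsi : psi X Q β (updateMean X Q v z) ^ 2 = (β - updateMean X Q v z).ofLp ⬝ᵥ
      (precision X Q *ᵥ (β - updateMean X Q v z).ofLp) := by
    rw [psi_eq_norm h, norm_whiten_sq h]
  have hb : precision X Q *ᵥ β.ofLp = Xᵀ *ᵥ (X *ᵥ β.ofLp) + Q *ᵥ β.ofLp := by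
    rw [precision, Matrix.add_mulVec, Matrix.mulVec_mulVec]
  set m := updateMean X Q v z
  rw [hpsi, hz]
  simp only [WithLp.ofLp_sub, Matrix.mulVec_sub, dotProduct_sub, sub_dotProduct]
  rw [hsymm h.isHermitian m.ofLp β.ofLp, hAm, hb, hsymm hQ.isHermitian v.ofLp β.ofLp,
    dotProduct_comm z (X *ᵥ β.ofLp), hXz, hXz, dotProduct_add, dotProduct_add]
  ring

lemma prod_stdNormalPDF (x : Fin n → ℝ) : ∏ i, stdNormalPDF (x i) =
    (√(2 * Real.pi))⁻¹ ^ n * Real.exp (-(∑ i, x i ^ 2) / 2) := by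
  simp only [stdNormalPDF_eq, Finset.prod_mul_distrib, Finset.prod_const, Finset.card_univ,
    Fintype.card_fin, ← Real.exp_sum, ← Finset.sum_div, Finset.sum_neg_distrib]

/-- After completing the square, the only dependence on β is a Gaussian factor centred at
`updateMean`; the remainder depends on z alone and goes into g. -/
lemma exists_jointWeight_eq (hQ : Q.PosSemidef) (h : (precision X Q).PosDef) :
    ∃ g : (Fin n → ℝ) → ℝ≥0∞, ∀ z,
      volume.withDensity (fun β => ENNReal.ofReal (jointWeight X Q v β z)) =
        g z • updateKernel X Q v z := by
  obtain ⟨C, hC0, hC, hd⟩ := multivariateGaussian_eq_withDensity h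
  refine ⟨fun z => ENNReal.ofReal ((√(2 * Real.pi))⁻¹ ^ n * Real.exp (-(z ⬝ᵥ z +
    v.ofLp ⬝ᵥ (Q *ᵥ v.ofLp) - (updateMean X Q v z).ofLp ⬝ᵥ
      (precision X Q *ᵥ (updateMean X Q v z).ofLp)) / 2)) * C⁻¹, fun z => ?_⟩
  change _ = _ • multivariateGaussian (updateMean X Q v z) (precision X Q)⁻¹
  rw [hd, smul_smul, mul_assoc, ENNReal.inv_mul_cancel hC0 hC, mul_one,
    ← withDensity_smul' _ _ ENNReal.ofReal_ne_top]
  congr 1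
  ext β
  rw [Pi.smul_apply, smul_eq_mul, ← ENNReal.ofReal_mul (by positivity), jointWeight,
    prod_stdNormalPDF, mul_assoc, mul_assoc, ← Real.exp_add, ← Real.exp_add]
  congr 3
  linarith [sum_sq_add_quadratic (v := v) hQ h z β]

lemma posterior_bind_acKernel (hQ : Q.PosSemidef) (h : (precision X Q).PosDef) :
    (posterior X Q v y).bind (acKernel X Q v y) = posterior X Q v y := by
  obtain ⟨g, hg⟩ := exists_jointWeight_eq (v := v) hQ h
  have key := withDensity_bind_comp (lE := (volume : Measure (EuclideanSpace ℝ (Fin p))))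
    (lZ := Measure.pi fun i => volume.restrict (halfLine (y i)))
    (measurable_posteriorWeight (X := X) (Q := Q) (v := v) (y := y)).ennreal_ofReal
    (j := fun β z => ENNReal.ofReal (jointWeight X Q v β z))
    (measurable_jointWeight (X := X) (Q := Q) (v := v)).ennreal_ofReal
    posteriorWeight_smul_latentKernel g hg
  rw [posterior]
  ext A hA
  rw [Measure.bind_apply hA (Kernel.measurable _).aemeasurable, lintegral_smul_measure,
    ← Measure.bind_apply hA (Kernel.measurable _).aemeasurable, acKernel, key, Measure.smul_apply]

end Invariance

/-! ### Properness and exponential tails of the posterior -/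

section Posterior

variable {n p : ℕ} {X : Matrix (Fin n) (Fin p) ℝ} {Q : Matrix (Fin p) (Fin p) ℝ}
  {v : EuclideanSpace ℝ (Fin p)} {y : Fin n → Bool}

/-- Chernoff's bound at parameter -1; an exponential rate is all that the tail estimate needs. -/
lemma exists_stdNormalCDF_neg_le : ∃ C : ℝ, 0 ≤ C ∧ ∀ s : ℝ, stdNormalCDF (-s) ≤ C * Real.exp (-s) := by
  refine ⟨mgf id (gaussianReal 0 1) (-1), mgf_nonneg, fun s => ?_⟩
  have h := measure_le_le_exp_mul_mgf (μ := gaussianReal 0 1) (X := id) (-s)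
    (show (-1 : ℝ) ≤ 0 by norm_num) (integrable_exp_mul_gaussianReal (-1))
  rw [stdNormalCDF, cdf_eq_real, mul_comm]
  simpa [Set.Iic] using h

lemma responseProb_le_one (a : Bool) (t : ℝ) : responseProb a t ≤ 1 := by
  cases a
  · simpa [responseProb] using (stdNormalCDF_pos t).le
  · simpa [responseProb] using (stdNormalCDF_lt_one t).le

/-- The posterior density decays exponentially as soon as both responses occur at every design
point. -/
lemma exists_posteriorWeight_le (hQ : Q.PosSemidef) (h : (precision X Q).PosDef)
    (hy : ∀ i b, ∃ j, X j = X i ∧ y j = b) :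
    ∃ C c : ℝ, 0 ≤ C ∧ 0 < c ∧ ∀ β, posteriorWeight X Q v y β ≤ C * Real.exp (-(c * ‖β - v‖)) := by
  obtain ⟨C₁, hC₁, hΦ⟩ := exists_stdNormalCDF_neg_le
  set K : ℝ := ‖unwhiten X Q‖ + 1
  have hK : 0 < K := by positivity
  -- The square of T = ‖Σ^{1/2}(β - v)‖ is a sum of n + 1 nonnegative terms, namely n squared
  -- predictors and the Q-form, so one of them is at least T²/(n + 1) = (κT)². A large predictor is
  -- penalized by the likelihood, a large Q-form by the prior.
  set κ : ℝ := (√(n + 1))⁻¹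
  have hκ : 0 < κ := by positivity
  have hκ2 : κ ^ 2 * (n + 1) = 1 := by
    rw [inv_pow, Real.sq_sqrt (by positivity)]
    field_simp
  refine ⟨Real.exp (1 / 2) + C₁ * ∑ i, Real.exp |linPred X v i|, κ / K, by positivity,
    by positivity, fun β => ?_⟩
  set P := ∏ i, responseProb (y i) (linPred X β i) with hP
  have hP1 : P ≤ 1 := Finset.prod_le_one (fun i _ => (responseProb_pos _ _).le)
    fun i _ => responseProb_le_one _ _
  have hP0 : 0 ≤ P := Finset.prod_nonneg fun i _ => (responseProb_pos _ _).le
  have hPi (i : Fin n) : P ≤ C₁ * Real.exp (-|linPred X β i|) := by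
    have hle (j : Fin n) : P ≤ responseProb (y j) (linPred X β j) := by
      rw [hP, ← Finset.mul_prod_erase _ _ (Finset.mem_univ j)]
      exact mul_le_of_le_one_right (responseProb_pos _ _).le (Finset.prod_le_one
        (fun i _ => (responseProb_pos _ _).le) fun i _ => responseProb_le_one _ _)
    refine le_trans ?_ (hΦ |linPred X β i|)
    -- The response disfavoured by the sign of the predictor: its likelihood factor is Φ(-|x_iᵀβ|).
    obtain ⟨j, hj, hyj⟩ := hy i (decide (linPred X β i ≤ 0))
    have hlin : linPred X β j = linPred X β i := by simp only [linPred, Matrix.mulVec, hj]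
    have := hle j
    rw [hlin, hyj] at this
    rcases le_or_gt (linPred X β i) 0 with h0 | h0
    · rw [abs_of_nonpos h0, neg_neg]
      simpa [responseProb, h0] using this
    · rw [abs_of_pos h0, stdNormalCDF_neg]
      simpa [responseProb, not_le.2 h0] using this
  set s2 : ℝ := (β - v).ofLp ⬝ᵥ (Q *ᵥ (β - v).ofLp) with hs2
  have hs0 : 0 ≤ s2 := hQ.dotProduct_mulVec_nonneg _
  have hw : posteriorWeight X Q v y β = P * Real.exp (-(1 / 2) * s2) := rfl
  set T := ‖whiten X Q (β - v)‖ with hT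
  have hT0 : 0 ≤ T := norm_nonneg _
  have hTsq : T ^ 2 = ∑ i, linPred X (β - v) i ^ 2 + s2 := by
    rw [hT, norm_whiten_sq h, precision, Matrix.add_mulVec, dotProduct_add, ← Matrix.mulVec_mulVec,
      Matrix.dotProduct_mulVec, Matrix.vecMul_transpose]
    simp only [dotProduct, linPred, sq]
    rfl
  have hnorm : ‖β - v‖ ≤ K * T := by
    calc ‖β - v‖ = ‖unwhiten X Q (whiten X Q (β - v))‖ := by rw [unwhiten_whiten h]
      _ ≤ ‖unwhiten X Q‖ * T := ContinuousLinearMap.le_opNorm _ _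
      _ ≤ K * T := by gcongr; linarith
  have hexp : Real.exp (-(κ * T)) ≤ Real.exp (-(κ / K * ‖β - v‖)) := by
    refine Real.exp_le_exp.2 (neg_le_neg ?_)
    calc κ / K * ‖β - v‖ ≤ κ / K * (K * T) := by gcongr
      _ = κ * T := by field_simp
  have hsum0 : 0 ≤ ∑ i, Real.exp |linPred X v i| := Finset.sum_nonneg fun i _ => (Real.exp_pos _).le
  rw [hw]
  suffices P * Real.exp (-(1 / 2) * s2) ≤
      (Real.exp (1 / 2) + C₁ * ∑ i, Real.exp |linPred X v i|) * Real.exp (-(κ * T)) from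
    this.trans (by gcongr)
  by_cases hcase : ∃ i, (κ * T) ^ 2 ≤ linPred X (β - v) i ^ 2
  · obtain ⟨i, hi⟩ := hcase
    have hi' : κ * T ≤ |linPred X (β - v) i| := abs_le_of_sq_le_sq' (by rwa [sq_abs])
      (abs_nonneg _) |>.2
    have hsub : linPred X (β - v) i = linPred X β i - linPred X v i := by
      simp [linPred, Matrix.mulVec_sub]
    have h2 : κ * T ≤ |linPred X β i| + |linPred X v i| := by
      rw [hsub] at hi'; exact hi'.trans (abs_sub _ _)
    calc P * Real.exp (-(1 / 2) * s2) ≤ C₁ * Real.exp (-|linPred X β i|) * 1 := by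
          gcongr
          · exact hPi i
          · rw [Real.exp_le_one_iff]; linarith
      _ ≤ C₁ * (Real.exp |linPred X v i| * Real.exp (-(κ * T))) := by
          rw [mul_one, ← Real.exp_add]
          gcongr
          linarith
      _ ≤ C₁ * ((∑ i, Real.exp |linPred X v i|) * Real.exp (-(κ * T))) := by
          gcongr
          exact Finset.single_le_sum (f := fun i => Real.exp |linPred X v i|)
            (fun i _ => (Real.exp_pos _).le) (Finset.mem_univ i)
      _ ≤ _ := by
          rw [add_mul, ← mul_assoc]
          exact le_add_of_nonneg_left (by positivity)
  · push Not at hcase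
    have hs : (κ * T) ^ 2 ≤ s2 := by
      have h3 : ∑ i, linPred X (β - v) i ^ 2 ≤ n * (κ * T) ^ 2 := by
        calc _ ≤ ∑ _i : Fin n, (κ * T) ^ 2 := Finset.sum_le_sum fun i _ => (hcase i).le
          _ = _ := by simp
      have h4 : T ^ 2 = (n + 1) * (κ * T) ^ 2 := by
        rw [mul_pow, ← mul_assoc, mul_comm ((n : ℝ) + 1), hκ2, one_mul]
      nlinarith
    calc P * Real.exp (-(1 / 2) * s2) ≤ 1 * Real.exp (1 / 2 + -(κ * T)) := by
          gcongr
          -- The Gaussian factor is weakened to an exponential one by a²/2 ≥ a - 1/2 with a = κT,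
          -- whence the constant exp (1/2).
          nlinarith [sq_nonneg (κ * T - 1)]
      _ = Real.exp (1 / 2) * Real.exp (-(κ * T)) := by rw [one_mul, Real.exp_add]
      _ ≤ _ := by
          gcongr
          exact le_add_of_nonneg_right (by positivity)

lemma posteriorProper_of_both (hQ : Q.PosSemidef) (h : (precision X Q).PosDef)
    (hy : ∀ i b, ∃ j, X j = X i ∧ y j = b) : PosteriorProper X Q v y := by
  obtain ⟨C, c, hC, hc, hle⟩ := exists_posteriorWeight_le (v := v) hQ h hy
  have hi : Integrable fun β => C * Real.exp (-(c * ‖β - v‖)) := by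
    have := ((integrable_pow_norm_mul_exp_neg (volume : Measure (EuclideanSpace ℝ (Fin p))) 0
      hc).comp_sub_right v).const_mul C
    simpa only [pow_zero, one_mul] using this
  exact (lintegral_mono fun β => ENNReal.ofReal_le_ofReal (hle β)).trans_lt hi.lintegral_lt_top

lemma posteriorMass_ne_zero : posteriorMass X Q v y ≠ 0 := by
  intro h0
  rw [posteriorMass, lintegral_eq_zero_iff measurable_posteriorWeight.ennreal_ofReal] at h0
  obtain ⟨β, hβ⟩ := h0.exists
  simp only [Pi.zero_apply, ENNReal.ofReal_eq_zero] at hβ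
  exact hβ.not_gt (posteriorWeight_pos β)

lemma isProbabilityMeasure_posterior (hp : PosteriorProper X Q v y) :
    IsProbabilityMeasure (posterior X Q v y) := by
  refine ⟨?_⟩
  rw [posterior, Measure.smul_apply, withDensity_apply _ MeasurableSet.univ, Measure.restrict_univ,
    smul_eq_mul]
  exact ENNReal.inv_mul_cancel posteriorMass_ne_zero hp.ne

lemma lintegral_psi_sq_posterior_ne_top (hQ : Q.PosSemidef) (h : (precision X Q).PosDef)
    (hy : ∀ i b, ∃ j, X j = X i ∧ y j = b) (x : EuclideanSpace ℝ (Fin p)) :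
    ∫⁻ b, ENNReal.ofReal (psi X Q x b) ^ 2 ∂posterior X Q v y ≠ ∞ := by
  obtain ⟨C, c, hC, hc, hle⟩ := exists_posteriorWeight_le (v := v) hQ h hy
  have hψ : Measurable fun b => psi X Q x b := (measurable_psi h).comp measurable_prodMk_left
  rw [posterior, lintegral_smul_measure, smul_eq_mul]
  refine ENNReal.mul_ne_top (ENNReal.inv_ne_top.2 posteriorMass_ne_zero) ?_
  rw [lintegral_withDensity_eq_lintegral_mul _ measurable_posteriorWeight.ennreal_ofReal
    (hψ.ennreal_ofReal.pow_const 2)]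
  set W := ‖whiten X Q‖
  have hi (k : ℕ) : Integrable fun b => ‖b - v‖ ^ k * Real.exp (-(c * ‖b - v‖)) :=
    (integrable_pow_norm_mul_exp_neg (volume : Measure (EuclideanSpace ℝ (Fin p))) k
      hc).comp_sub_right v
  have hI := ((hi 0).const_mul (2 * C * W ^ 2 * ‖x - v‖ ^ 2)).add
    ((hi 2).const_mul (2 * C * W ^ 2))
  refine ((lintegral_mono fun b => ?_).trans_lt hI.lintegral_lt_top).ne
  have h0 : 0 ≤ psi X Q x b := Real.sqrt_nonneg _
  rw [Pi.mul_apply, ← ENNReal.ofReal_pow h0,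
    ← ENNReal.ofReal_mul (posteriorWeight_pos b).le]
  refine ENNReal.ofReal_le_ofReal ?_
  have h1 : psi X Q x b ≤ W * (‖x - v‖ + ‖b - v‖) := by
    rw [psi_eq_norm h]
    refine (ContinuousLinearMap.le_opNorm _ _).trans ?_
    gcongr
    rw [← sub_sub_sub_cancel_right x b v]
    exact norm_sub_le _ _
  have h2 : psi X Q x b ^ 2 ≤ 2 * W ^ 2 * (‖x - v‖ ^ 2 + ‖b - v‖ ^ 2) := by
    have : psi X Q x b ^ 2 ≤ (W * (‖x - v‖ + ‖b - v‖)) ^ 2 := by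
      gcongr
    rw [mul_pow] at this
    nlinarith [mul_nonneg (sq_nonneg W) (sq_nonneg (‖x - v‖ - ‖b - v‖))]
  calc posteriorWeight X Q v y b * psi X Q x b ^ 2
      ≤ (C * Real.exp (-(c * ‖b - v‖))) * (2 * W ^ 2 * (‖x - v‖ ^ 2 + ‖b - v‖ ^ 2)) := by
        gcongr; exact hle b
    _ = _ := by simp only [Pi.add_apply]; ring

end Posterior

/-! ### Mean-square contraction of the synchronous coupling -/

section Contraction

variable {n p : ℕ} {X : Matrix (Fin n) (Fin p) ℝ} {Q : Matrix (Fin p) (Fin p) ℝ}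
  {v : EuclideanSpace ℝ (Fin p)} {y : Fin n → Bool}

/-- The mean square of a linear combination of vectors with independent bounded coefficients. -/
lemma lintegral_norm_sum_smul_sq_le {ι : Type*} [Fintype ι] (μ : ι → Measure ℝ)
    [∀ i, IsProbabilityMeasure (μ i)] {f : ι → ℝ → ℝ} (hf : ∀ i, Measurable (f i)) {M : ι → ℝ}
    (hM : ∀ i, ∀ᵐ u ∂μ i, |f i u| ≤ M i) (w : ι → EuclideanSpace ℝ (Fin p)) :
    ∫⁻ u, ENNReal.ofReal ‖∑ i, f i (u i) • w i‖ ^ 2 ∂Measure.pi μ ≤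
      ENNReal.ofReal (‖∑ i, (∫ u, f i u ∂μ i) • w i‖ ^ 2 + ∑ i, M i ^ 2 * ‖w i‖ ^ 2) := by
  have hcoord (a : ι → ℝ) : ‖∑ i, a i • w i‖ ^ 2 = ∑ k, (∑ i, a i * w i k) ^ 2 := by
    rw [EuclideanSpace.real_norm_sq_eq]
    refine Finset.sum_congr rfl fun k _ => ?_
    simp [WithLp.ofLp_sum, Finset.sum_apply]
  have hmem (i : ι) : MemLp (f i) 2 (μ i) :=
    MemLp.of_bound (hf i).aestronglyMeasurable (M i) (hM i)
  have hmemk (k : Fin p) (i : ι) : MemLp (fun u => f i u * w i k) 2 (μ i) := (hmem i).mul_const _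
  have hmemS (k : Fin p) : MemLp (fun u : ι → ℝ => ∑ i, f i (u i) * w i k) 2 (Measure.pi μ) :=
    memLp_finsetSum _ fun i _ =>
      (hmemk k i).comp_measurePreserving (measurePreserving_eval μ i)
  have hint (k : Fin p) : ∫ u, (∑ i, f i (u i) * w i k) ∂Measure.pi μ =
      ∑ i, (∫ u, f i u ∂μ i) * w i k := by
    have hi (i : ι) : Integrable (fun u : ι → ℝ => f i (u i) * w i k) (Measure.pi μ) :=
      ((hmemk k i).comp_measurePreserving (measurePreserving_eval μ i)).integrable (by norm_num)
    rw [integral_finsetSum _ fun i _ => hi i]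
    refine Finset.sum_congr rfl fun i _ => ?_
    rw [← integral_mul_const, ← (measurePreserving_eval μ i).map_eq,
      integral_map (measurable_pi_apply i).aemeasurable
        ((hf i).mul_const _).aestronglyMeasurable]
  -- In each coordinate the second moment is the squared mean plus the variance. By independence the
  -- variances add, and each is at most the second moment of its own term.
  have hvar (k : Fin p) : ∫ u, (∑ i, f i (u i) * w i k) ^ 2 ∂Measure.pi μ ≤
      (∑ i, (∫ u, f i u ∂μ i) * w i k) ^ 2 + ∑ i, M i ^ 2 * w i k ^ 2 := by
    have h1 := variance_eq_sub (hmemS k)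
    have h2 := variance_sum_pi (hmemk k)
    have e : (∑ i, fun u : ι → ℝ => f i (u i) * w i k) =
        fun u : ι → ℝ => ∑ i, f i (u i) * w i k := by
      ext u; simp
    rw [e, h1, hint] at h2
    have h3 : ∑ i, Var[fun u => f i u * w i k; μ i] ≤ ∑ i, M i ^ 2 * w i k ^ 2 := by
      refine Finset.sum_le_sum fun i _ => ?_
      refine (variance_le_expectation_sq (hmemk k i).1).trans ?_
      calc ∫ u, ((fun u => f i u * w i k) ^ 2) u ∂μ i ≤ ∫ _u, M i ^ 2 * w i k ^ 2 ∂μ i := by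
            refine integral_mono_ae (hmemk k i).integrable_sq (integrable_const _) ?_
            filter_upwards [hM i] with u hu
            simp only [Pi.pow_apply, mul_pow]
            exact mul_le_mul_of_nonneg_right
              (sq_le_sq' (by linarith [abs_le.1 hu]) (abs_le.1 hu).2) (sq_nonneg _)
        _ = _ := by simp
    simp only [Pi.pow_apply] at h2
    linarith
  have hI (k : Fin p) : Integrable (fun u : ι → ℝ => (∑ i, f i (u i) * w i k) ^ 2)
      (Measure.pi μ) := (hmemS k).integrable_sq
  calc ∫⁻ u, ENNReal.ofReal ‖∑ i, f i (u i) • w i‖ ^ 2 ∂Measure.pi μ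
      = ∫⁻ u, ENNReal.ofReal (∑ k, (∑ i, f i (u i) * w i k) ^ 2) ∂Measure.pi μ := by
        refine lintegral_congr fun u => ?_
        rw [← ENNReal.ofReal_pow (norm_nonneg _), hcoord fun i => f i (u i)]
    _ = ENNReal.ofReal (∑ k, ∫ u, (∑ i, f i (u i) * w i k) ^ 2 ∂Measure.pi μ) := by
        rw [← ofReal_integral_eq_lintegral_ofReal (integrable_finsetSum _ fun k _ => hI k)
          (ae_of_all _ fun u => Finset.sum_nonneg fun k _ => sq_nonneg _),
          integral_finsetSum _ fun k _ => hI k]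
    _ ≤ _ := by
        refine ENNReal.ofReal_le_ofReal ((Finset.sum_le_sum fun k _ => hvar k).trans_eq ?_)
        rw [Finset.sum_add_distrib, hcoord, Finset.sum_comm]
        simp_rw [EuclideanSpace.real_norm_sq_eq, Finset.mul_sum]

open Classical in
/-- If both responses make up a positive fraction at every design point, then coefficients which
are small for one of the responses are small on average. -/
lemma sum_response_le {η : ℝ}
    (hbal : ∀ i b, η * (Finset.univ.filter fun j => X j = X i).card ≤
      (Finset.univ.filter fun j => X j = X i ∧ y j = b).card)
    {d : Bool → (Fin p → ℝ) → ℝ} (hd1 : ∀ b x, d b x ≤ 1)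
    (hd : ∀ x, d true x + d false x ≤ 7 / 4) {g : (Fin p → ℝ) → ℝ} (hg : ∀ x, 0 ≤ g x) :
    ∑ j, d (y j) (X j) * g (X j) ≤ (1 - η / 4) * ∑ j, g (X j) := by
  suffices h : η / 4 * ∑ j, g (X j) ≤ ∑ j, (1 - d (y j) (X j)) * g (X j) by
    simp only [sub_mul, one_mul, Finset.sum_sub_distrib] at h
    linarith
  have hmaps : ∀ j ∈ (Finset.univ : Finset (Fin n)), X j ∈ Finset.univ.image fun j => X j :=
    fun j _ => Finset.mem_image_of_mem _ (Finset.mem_univ j)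
  rw [← Finset.sum_fiberwise_of_maps_to hmaps fun j => g (X j),
    ← Finset.sum_fiberwise_of_maps_to hmaps fun j => (1 - d (y j) (X j)) * g (X j),
    Finset.mul_sum]
  refine Finset.sum_le_sum fun x hx => ?_
  obtain ⟨i, -, rfl⟩ := Finset.mem_image.1 hx
  have e1 : ∑ j ∈ Finset.univ.filter (fun j => X j = X i), g (X j) =
      (Finset.univ.filter fun j => X j = X i).card * g (X i) := by
    rw [Finset.sum_congr rfl fun j hj => by rw [(Finset.mem_filter.1 hj).2], Finset.sum_const,
      nsmul_eq_mul]
  have e2 : ∑ j ∈ Finset.univ.filter (fun j => X j = X i), (1 - d (y j) (X j)) * g (X j) =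
      ((Finset.univ.filter fun j => X j = X i ∧ y j = true).card * (1 - d true (X i)) +
        (Finset.univ.filter fun j => X j = X i ∧ y j = false).card * (1 - d false (X i))) *
          g (X i) := by
    rw [Finset.sum_congr rfl fun j hj => by rw [(Finset.mem_filter.1 hj).2], ← Finset.sum_mul]
    congr 1
    rw [← Finset.sum_filter_add_sum_filter_not _ (fun j => y j = true), Finset.filter_filter,
      Finset.filter_filter]
    simp only [Bool.not_eq_true]
    rw [Finset.sum_congr rfl fun j hj => by rw [(Finset.mem_filter.1 hj).2.2], Finset.sum_const,
      nsmul_eq_mul, Finset.sum_congr (s₁ := Finset.univ.filter fun j => X j = X i ∧ y j = false) rfl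
        fun j hj => by rw [(Finset.mem_filter.1 hj).2.2], Finset.sum_const, nsmul_eq_mul]
  suffices key : η / 4 * ∑ j ∈ Finset.univ.filter (fun j => X j = X i), g (X j) ≤
      ∑ j ∈ Finset.univ.filter (fun j => X j = X i), (1 - d (y j) (X j)) * g (X j) by
    refine (le_of_eq ?_).trans (key.trans (le_of_eq ?_)) <;> congr!
  rw [e1, e2, ← mul_assoc]
  refine mul_le_mul_of_nonneg_right ?_ (hg _)
  -- A group of N equal rows contributes at least ηN times (1 - d true) + (1 - d false) ≥ 2 - 7/4,
  -- which is the gain η/4. For η < 0 the left side is nonpositive and the right side nonnegative.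
  have h1 := mul_le_mul_of_nonneg_right (hbal i true) (sub_nonneg.2 (hd1 true (X i)))
  have h0 := mul_le_mul_of_nonneg_right (hbal i false) (sub_nonneg.2 (hd1 false (X i)))
  by_cases hη : 0 ≤ η
  · have h2 := mul_nonneg hη (Nat.cast_nonneg (α := ℝ)
      (Finset.univ.filter fun j => X j = X i).card)
    nlinarith [hd (X i)]
  · have h2 := mul_nonneg (neg_nonneg.2 (not_le.1 hη).le) (Nat.cast_nonneg (α := ℝ)
      (Finset.univ.filter fun j => X j = X i).card)
    have := mul_nonneg (Nat.cast_nonneg (α := ℝ)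
      (Finset.univ.filter fun j => X j = X i ∧ y j = true).card) (sub_nonneg.2 (hd1 true (X i)))
    have := mul_nonneg (Nat.cast_nonneg (α := ℝ)
      (Finset.univ.filter fun j => X j = X i ∧ y j = false).card) (sub_nonneg.2 (hd1 false (X i)))
    linarith

/-- This is XᵀX ≤ Σ; in whitened coordinates, ∑ w_i w_iᵀ ≤ I. -/
lemma sum_linPred_sq_le (hQ : Q.PosSemidef) (h : (precision X Q).PosDef)
    (d : EuclideanSpace ℝ (Fin p)) : ∑ i, linPred X d i ^ 2 ≤ ‖whiten X Q d‖ ^ 2 := by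
  have hs0 : 0 ≤ d.ofLp ⬝ᵥ (Q *ᵥ d.ofLp) := hQ.dotProduct_mulVec_nonneg _
  have e : ‖whiten X Q d‖ ^ 2 = ∑ i, linPred X d i ^ 2 + d.ofLp ⬝ᵥ (Q *ᵥ d.ofLp) := by
    rw [norm_whiten_sq h, precision, Matrix.add_mulVec, dotProduct_add, ← Matrix.mulVec_mulVec,
      Matrix.dotProduct_mulVec d.ofLp Xᵀ, Matrix.vecMul_transpose]
    simp only [dotProduct, linPred, sq]
  linarith

/-- The whitened design vector `Σ^{-1/2} x_i`. -/
def whitenedRow (X : Matrix (Fin n) (Fin p) ℝ) (Q : Matrix (Fin p) (Fin p) ℝ) (i : Fin n) :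
    EuclideanSpace ℝ (Fin p) := WithLp.toLp 2 (covSqrt X Q *ᵥ X i)

lemma inner_whitenedRow (i : Fin n) (e : EuclideanSpace ℝ (Fin p)) :
    inner ℝ (whitenedRow X Q i) e = linPred X (unwhiten X Q e) i := by
  rw [EuclideanSpace.inner_eq_star_dotProduct, linPred, ofLp_unwhiten]
  change e.ofLp ⬝ᵥ (covSqrt X Q *ᵥ X i) = X i ⬝ᵥ (covSqrt X Q *ᵥ e.ofLp)
  rw [Matrix.dotProduct_mulVec, ← Matrix.mulVec_transpose, covSqrt_transpose, dotProduct_comm]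

lemma dotProduct_mulVec_le_lambdaMax {A : Matrix (Fin p) (Fin p) ℝ} (hA : A.IsHermitian)
    (x : EuclideanSpace ℝ (Fin p)) : x.ofLp ⬝ᵥ (A *ᵥ x.ofLp) ≤ lambdaMax A * ‖x‖ ^ 2 := by
  have hbdd : BddAbove (spectrum ℝ A) := by
    rw [hA.spectrum_real_eq_range_eigenvalues]
    exact (Set.finite_range _).bddAbove
  have hle : A ≤ algebraMap ℝ _ (lambdaMax A) :=
    le_algebraMap_of_spectrum_le (fun t ht => le_csSup hbdd ht) hA.isSelfAdjoint
  have h0 : 0 ≤ x.ofLp ⬝ᵥ ((algebraMap ℝ (Matrix (Fin p) (Fin p) ℝ) (lambdaMax A) - A) *ᵥ x.ofLp) :=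
    (Matrix.le_iff.1 hle).dotProduct_mulVec_nonneg _
  rw [Algebra.algebraMap_eq_smul_one, Matrix.sub_mulVec, dotProduct_sub, Matrix.smul_mulVec,
    Matrix.one_mulVec, dotProduct_smul, smul_eq_mul, ← norm_sq_eq_dotProduct] at h0
  linarith

/-- Since (w wᵀ)² = ‖w‖² w wᵀ, the left side is the quadratic form at e of the matrix whose largest
eigenvalue defines σ². -/
lemma sum_inner_sq_mul_norm_sq_le (e : EuclideanSpace ℝ (Fin p)) :
    ∑ i, (inner ℝ (whitenedRow X Q i) e) ^ 2 * ‖whitenedRow X Q i‖ ^ 2 ≤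
      sigmaErr X Q ^ 2 * ‖e‖ ^ 2 := by
  set R := covSqrt X Q with hR
  set B : Fin n → Matrix (Fin p) (Fin p) ℝ :=
    fun i => R * Matrix.vecMulVec (X i) (X i) * R with hB
  have hBt (i : Fin n) : (B i)ᵀ = B i := by
    simp only [hB, Matrix.transpose_mul, Matrix.transpose_vecMulVec, hR, covSqrt_transpose,
      Matrix.mul_assoc]
  have hherm : (∑ i, B i ^ 2).IsHermitian := by
    rw [Matrix.IsHermitian, Matrix.conjTranspose_eq_transpose_of_trivial, Matrix.transpose_sum]
    refine Finset.sum_congr rfl fun i _ => ?_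
    rw [Matrix.transpose_pow, hBt]
  have hBe (i : Fin n) : B i *ᵥ e.ofLp =
      inner ℝ (whitenedRow X Q i) e • (whitenedRow X Q i).ofLp := by
    rw [inner_whitenedRow, linPred, ofLp_unwhiten]
    simp only [hB, ← Matrix.mulVec_mulVec, Matrix.vecMulVec_mulVec]
    rw [op_smul_eq_smul, Matrix.mulVec_smul]
    rfl
  have hsum : ∑ i, (inner ℝ (whitenedRow X Q i) e) ^ 2 * ‖whitenedRow X Q i‖ ^ 2 =
      e.ofLp ⬝ᵥ ((∑ i, B i ^ 2) *ᵥ e.ofLp) := by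
    rw [Matrix.sum_mulVec, dotProduct_sum]
    refine Finset.sum_congr rfl fun i _ => ?_
    rw [sq (B i), ← Matrix.mulVec_mulVec, Matrix.dotProduct_mulVec, ← Matrix.mulVec_transpose, hBt,
      hBe, smul_dotProduct, dotProduct_smul, ← norm_sq_eq_dotProduct, smul_eq_mul, smul_eq_mul]
    ring
  rw [hsum]
  refine (dotProduct_mulVec_le_lambdaMax hherm e).trans ?_
  gcongr
  change lambdaMax (∑ i, B i ^ 2) ≤ √(lambdaMax (∑ i, B i ^ 2)) ^ 2
  rcases le_or_gt 0 (lambdaMax (∑ i, B i ^ 2)) with h0 | h0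
  · rw [Real.sq_sqrt h0]
  · exact h0.le.trans (sq_nonneg _)

/-- The noise driving one step of the chain. -/
def acNoise (n p : ℕ) : Measure ((Fin n → ℝ) × EuclideanSpace ℝ (Fin p)) :=
  (Measure.pi fun _ => unif).prod (stdGaussian _)

instance : IsProbabilityMeasure (acNoise n p) := by unfold acNoise; infer_instance

/-- The latent variables obtained by the quantile transform. -/
def latentMap (X : Matrix (Fin n) (Fin p) ℝ) (y : Fin n → Bool) (β : EuclideanSpace ℝ (Fin p))
    (u : Fin n → ℝ) (i : Fin n) : ℝ :=
  truncQuantile (y i) (linPred X β i) (u i)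

/-- One step of the chain as a random map. -/
def acMap (X : Matrix (Fin n) (Fin p) ℝ) (Q : Matrix (Fin p) (Fin p) ℝ)
    (v : EuclideanSpace ℝ (Fin p)) (y : Fin n → Bool) (β : EuclideanSpace ℝ (Fin p))
    (ξ : (Fin n → ℝ) × EuclideanSpace ℝ (Fin p)) : EuclideanSpace ℝ (Fin p) :=
  updateMean X Q v (latentMap X y β ξ.1) + unwhiten X Q ξ.2

lemma measurable_updateMean : Measurable (updateMean X Q v) := by
  have : Continuous (updateMean X Q v) := by
    unfold updateMean
    fun_prop
  exact this.measurable

lemma measurable_latentMap : Measurable (Function.uncurry (latentMap X y)) := by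
  refine measurable_pi_lambda _ fun i => (measurable_truncQuantile (y i)).comp
    (((measurable_linPred i).comp measurable_fst).prodMk ?_)
  exact (measurable_pi_apply i).comp measurable_snd

lemma measurable_acMap : Measurable (Function.uncurry (acMap X Q v y)) := by
  have h1 : Measurable fun w : EuclideanSpace ℝ (Fin p) × ((Fin n → ℝ) × EuclideanSpace ℝ (Fin p)) =>
      latentMap X y w.1 w.2.1 :=
    measurable_latentMap.comp (measurable_fst.prodMk measurable_snd.fst)
  refine (measurable_updateMean.comp h1).add ?_
  have : Measurable (unwhiten X Q) := by fun_prop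
  exact this.comp measurable_snd.snd

lemma map_latentMap (β : EuclideanSpace ℝ (Fin p)) :
    (Measure.pi fun _ => unif).map (latentMap X y β) = latentKernel X y β := by
  have hm (i : Fin n) : Measurable (truncQuantile (y i) (linPred X β i)) :=
    (measurable_truncQuantile (y i)).comp measurable_prodMk_left
  have (i : Fin n) : IsProbabilityMeasure (unif.map (truncQuantile (y i) (linPred X β i))) :=
    Measure.isProbabilityMeasure_map (hm i).aemeasurable
  have := Measure.pi_map_pi (μ := fun _ : Fin n => unif)
    (f := fun i => truncQuantile (y i) (linPred X β i)) fun i => (hm i).aemeasurable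
  simp_rw [map_truncQuantile] at this
  exact this

lemma updateKernel_apply_eq (z : Fin n → ℝ) {A : Set (EuclideanSpace ℝ (Fin p))}
    (hA : MeasurableSet A) : updateKernel X Q v z A =
      stdGaussian (EuclideanSpace ℝ (Fin p)) {w | updateMean X Q v z + unwhiten X Q w ∈ A} := by
  change multivariateGaussian (updateMean X Q v z) (precision X Q)⁻¹ A = _
  rw [multivariateGaussian_eq_map, Measure.map_apply (by fun_prop) hA]
  rfl

lemma acKernel_eq_map (β : EuclideanSpace ℝ (Fin p)) :
    acKernel X Q v y β = (acNoise n p).map (acMap X Q v y β) := by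
  have hl : Measurable (latentMap X y β) := measurable_latentMap.comp measurable_prodMk_left
  have hm : Measurable (acMap X Q v y β) :=
    (measurable_acMap (X := X) (Q := Q) (v := v) (y := y)).of_uncurry_left
  ext A hA
  have h1 : acKernel X Q v y β A =
      ∫⁻ u, updateKernel X Q v (latentMap X y β u) A ∂Measure.pi fun _ : Fin n => unif := by
    rw [acKernel, Kernel.comp_apply' _ _ _ hA, ← map_latentMap,
      lintegral_map (Kernel.measurable_coe _ hA) hl]
  have h2 : (acNoise n p).map (acMap X Q v y β) A = ∫⁻ u, stdGaussian (EuclideanSpace ℝ (Fin p))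
      (Prod.mk u ⁻¹' (acMap X Q v y β ⁻¹' A)) ∂Measure.pi fun _ : Fin n => unif := by
    rw [Measure.map_apply hm hA, acNoise, Measure.prod_apply (hm hA)]
  rw [h1, h2]
  refine lintegral_congr fun u => ?_
  rw [updateKernel_apply_eq _ hA]
  rfl

/-- The prior term Qv cancels, and Σ^{1/2} Σ⁻¹ Xᵀ = Σ^{-1/2} Xᵀ has the whitened rows as columns. -/
lemma whiten_updateMean_sub (h : (precision X Q).PosDef) (z z' : Fin n → ℝ) :
    whiten X Q (updateMean X Q v z - updateMean X Q v z') =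
      ∑ i, (z i - z' i) • whitenedRow X Q i := by
  have e1 : (updateMean X Q v z - updateMean X Q v z').ofLp =
      covSqrt X Q *ᵥ (covSqrt X Q *ᵥ (Xᵀ *ᵥ (z - z'))) := by
    rw [Matrix.mulVec_mulVec, covSqrt_mul_self h, WithLp.ofLp_sub]
    simp only [updateMean]
    rw [← Matrix.mulVec_sub, add_sub_add_right_eq_sub, ← Matrix.mulVec_sub]
  apply WithLp.ofLp_injective
  rw [ofLp_whiten, e1, Matrix.mulVec_mulVec, Matrix.nonsing_inv_mul _ (isUnit_det_covSqrt h),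
    Matrix.one_mulVec, Matrix.mulVec_transpose, Matrix.vecMul_eq_sum, Matrix.mulVec_sum,
    WithLp.ofLp_sum]
  refine Finset.sum_congr rfl fun i _ => ?_
  rw [Matrix.mulVec_smul]
  rfl

open Classical in
/-- The Albert and Chib chain contracts in mean square when both responses make up a positive
fraction at every design point. -/
lemma lintegral_psi_acMap_sq_le (hQ : Q.PosSemidef) (h : (precision X Q).PosDef) {η : ℝ}
    (hη : η < 4)
    (hbal : ∀ i b, η * (Finset.univ.filter fun j => X j = X i).card ≤
      (Finset.univ.filter fun j => X j = X i ∧ y j = b).card)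
    (β β' : EuclideanSpace ℝ (Fin p)) :
    ∫⁻ ξ, ENNReal.ofReal (psi X Q (acMap X Q v y β ξ) (acMap X Q v y β' ξ)) ^ 2 ∂acNoise n p ≤
      ENNReal.ofReal (((1 - η / 4) ^ 2 + sigmaErr X Q ^ 2) * psi X Q β β' ^ 2) := by
  set κ := 1 - η / 4 with hκdef
  have hκ : 0 < κ := by linarith
  set ω := whiten X Q (β - β') with hω
  have hδ (i : Fin n) : inner ℝ (whitenedRow X Q i) ω = linPred X β i - linPred X β' i := by
    rw [inner_whitenedRow, hω, unwhiten_whiten h]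
    simp [linPred, Matrix.mulVec_sub]
  set f : Fin n → ℝ → ℝ := fun i u => truncQuantile (y i) (linPred X β i) u -
    truncQuantile (y i) (linPred X β' i) u with hf
  have hfm (i : Fin n) : Measurable (f i) :=
    ((measurable_truncQuantile (y i)).comp measurable_prodMk_left).sub
      ((measurable_truncQuantile (y i)).comp measurable_prodMk_left)
  have hfb (i : Fin n) : ∀ᵐ u ∂unif, |f i u| ≤ |inner ℝ (whitenedRow X Q i) ω| := by
    have hae : ∀ᵐ u ∂unif, u ∈ Set.Ioo (0 : ℝ) 1 := ae_restrict_mem measurableSet_Ioo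
    filter_upwards [hae] with u hu
    rw [hδ]
    exact abs_truncQuantile_sub_le _ hu _ _
  set s : Fin n → ℝ := fun i => truncSlope (y i) (linPred X β' i) (linPred X β i) with hs
  have hfi (i : Fin n) : ∫ u, f i u ∂unif = s i * inner ℝ (whitenedRow X Q i) ω := by
    rw [hδ, hs, truncSlope_mul]
    exact integral_sub (integrable_truncQuantile _ _) (integrable_truncQuantile _ _)
  -- The Gaussian noise is common to both copies and drops out of the difference.
  have hpsi (ξ : (Fin n → ℝ) × EuclideanSpace ℝ (Fin p)) :
      psi X Q (acMap X Q v y β ξ) (acMap X Q v y β' ξ) =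
        ‖∑ i, f i (ξ.1 i) • whitenedRow X Q i‖ := by
    rw [psi_eq_norm h, acMap, acMap, add_sub_add_right_eq_sub, whiten_updateMean_sub h]
    rfl
  set e := ∑ i, (∫ u, f i u ∂unif) • whitenedRow X Q i with he
  have hs0 (i : Fin n) : 0 ≤ s i := (truncSlope_mem _ _ _).1
  -- The operator A = ∑ s_i w_i w_iᵀ satisfies A ≤ κ I. The slopes depend on i only through the row
  -- and the response, so the groupwise estimate applies with squared predictors as weights.
  have hsum (a : EuclideanSpace ℝ (Fin p)) :
      ∑ i, s i * (inner ℝ (whitenedRow X Q i) a) ^ 2 ≤ κ * ‖a‖ ^ 2 := by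
    calc ∑ i, s i * (inner ℝ (whitenedRow X Q i) a) ^ 2
        ≤ κ * ∑ i, linPred X (unwhiten X Q a) i ^ 2 := by
          have := sum_response_le hbal
            (d := fun b x => truncSlope b (x ⬝ᵥ β'.ofLp) (x ⬝ᵥ β.ofLp))
            (fun b x => (truncSlope_mem _ _ _).2) (fun x => truncSlope_add_le _ _)
            (g := fun x => (x ⬝ᵥ (unwhiten X Q a).ofLp) ^ 2) (fun x => sq_nonneg _)
          simp_rw [inner_whitenedRow]
          exact this
      _ ≤ κ * ‖a‖ ^ 2 := by
          gcongr
          simpa only [whiten_unwhiten h] using sum_linPred_sq_le hQ h (unwhiten X Q a)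
  -- Here e = Aω, and ‖e‖² is the A-form of ω and e. The weighted inequality ab ≤ κa²/2 + b²/(2κ)
  -- with A ≤ κ I gives ‖e‖² ≤ κ²‖ω‖²/2 + ‖e‖²/2.
  have hmean : ‖e‖ ^ 2 ≤ κ ^ 2 * ‖ω‖ ^ 2 := by
    have h1 : ‖e‖ ^ 2 = ∑ i, s i * (inner ℝ (whitenedRow X Q i) ω *
        inner ℝ (whitenedRow X Q i) e) := by
      rw [← real_inner_self_eq_norm_sq]
      nth_rewrite 1 [he]
      rw [sum_inner]
      refine Finset.sum_congr rfl fun i _ => ?_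
      rw [real_inner_smul_left, hfi, mul_assoc]
    have h2 : ∑ i, s i * (inner ℝ (whitenedRow X Q i) ω * inner ℝ (whitenedRow X Q i) e) ≤
        κ / 2 * ∑ i, s i * (inner ℝ (whitenedRow X Q i) ω) ^ 2 +
          1 / (2 * κ) * ∑ i, s i * (inner ℝ (whitenedRow X Q i) e) ^ 2 := by
      rw [Finset.mul_sum, Finset.mul_sum, ← Finset.sum_add_distrib]
      refine Finset.sum_le_sum fun i _ => ?_
      have h3 : inner ℝ (whitenedRow X Q i) ω * inner ℝ (whitenedRow X Q i) e ≤
          κ / 2 * (inner ℝ (whitenedRow X Q i) ω) ^ 2 +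
            1 / (2 * κ) * (inner ℝ (whitenedRow X Q i) e) ^ 2 := by
        rw [← sub_nonneg]
        have : κ / 2 * (inner ℝ (whitenedRow X Q i) ω) ^ 2 +
            1 / (2 * κ) * (inner ℝ (whitenedRow X Q i) e) ^ 2 -
            inner ℝ (whitenedRow X Q i) ω * inner ℝ (whitenedRow X Q i) e =
            (κ * inner ℝ (whitenedRow X Q i) ω - inner ℝ (whitenedRow X Q i) e) ^ 2 / (2 * κ) := by
          field_simp
          ring
        rw [this]
        positivity
      nlinarith [mul_le_mul_of_nonneg_left h3 (hs0 i)]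
    have h4 : κ / 2 * ∑ i, s i * (inner ℝ (whitenedRow X Q i) ω) ^ 2 ≤ κ / 2 * (κ * ‖ω‖ ^ 2) := by
      gcongr; exact hsum ω
    have h5 : 1 / (2 * κ) * ∑ i, s i * (inner ℝ (whitenedRow X Q i) e) ^ 2 ≤
        1 / (2 * κ) * (κ * ‖e‖ ^ 2) := by
      gcongr; exact hsum e
    have h6 : 1 / (2 * κ) * (κ * ‖e‖ ^ 2) = ‖e‖ ^ 2 / 2 := by field_simp
    nlinarith
  have hvar := sum_inner_sq_mul_norm_sq_le (X := X) (Q := Q) ω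
  have hF : Measurable fun u : Fin n → ℝ =>
      ENNReal.ofReal ‖∑ i, f i (u i) • whitenedRow X Q i‖ ^ 2 := by
    have (i : Fin n) : Measurable fun u : Fin n → ℝ => f i (u i) :=
      (hfm i).comp (measurable_pi_apply i)
    fun_prop
  calc ∫⁻ ξ, ENNReal.ofReal (psi X Q (acMap X Q v y β ξ) (acMap X Q v y β' ξ)) ^ 2 ∂acNoise n p
      = ∫⁻ u, ENNReal.ofReal ‖∑ i, f i (u i) • whitenedRow X Q i‖ ^ 2
          ∂Measure.pi fun _ => unif := by
        simp_rw [hpsi]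
        exact measurePreserving_fst.lintegral_comp hF
    _ ≤ ENNReal.ofReal (‖e‖ ^ 2 + ∑ i, |inner ℝ (whitenedRow X Q i) ω| ^ 2 *
          ‖whitenedRow X Q i‖ ^ 2) := lintegral_norm_sum_smul_sq_le _ hfm hfb _
    _ ≤ _ := by
        refine ENNReal.ofReal_le_ofReal ?_
        simp_rw [sq_abs]
        rw [psi_eq_norm h, ← hω]
        linarith

end Contraction

/-! ### Lipschitz transition probabilities and the rates for balanced responses -/

section Lipschitz

variable {n p : ℕ} {X : Matrix (Fin n) (Fin p) ℝ} {Q : Matrix (Fin p) (Fin p) ℝ}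
  {v : EuclideanSpace ℝ (Fin p)} {y : Fin n → Bool}

lemma acKernel_real_eq_integral (β : EuclideanSpace ℝ (Fin p))
    {A : Set (EuclideanSpace ℝ (Fin p))} (hA : MeasurableSet A) :
    (acKernel X Q v y β).real A =
      ∫ u, (updateKernel X Q v (latentMap X y β u)).real A ∂Measure.pi fun _ : Fin n => unif := by
  have hl : Measurable (latentMap X y β) := measurable_latentMap.of_uncurry_left
  have hm := (Kernel.measurable_coe (updateKernel X Q v) hA).comp hl
  rw [Measure.real, acKernel, Kernel.comp_apply' _ _ _ hA, ← map_latentMap,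
    lintegral_map (Kernel.measurable_coe _ hA) hl]
  exact (integral_toReal hm.aemeasurable (ae_of_all _ fun u => measure_lt_top _ _)).symm

/-- The transition probabilities of the Albert and Chib chain are Lipschitz functions of the
current state. -/
lemma exists_acKernel_lipschitz (h : (precision X Q).PosDef) :
    ∃ L : ℝ≥0, ∀ A, MeasurableSet A → ∀ b b',
      |(acKernel X Q v y b).real A - (acKernel X Q v y b').real A| ≤ L * psi X Q b b' := by
  obtain ⟨L, hL⟩ := multivariateGaussian_lipschitz h
  -- The i-th latent variable moves by at most |⟨w_i, ω⟩| ≤ ‖w_i‖ ψ(b, b'), and this moves the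
  -- whitened mean by at most a further factor ‖w_i‖.
  refine ⟨L * ∑ i, ‖whitenedRow X Q i‖₊ ^ 2, fun A hA b b' => ?_⟩
  have hint (b : EuclideanSpace ℝ (Fin p)) : Integrable (fun u : Fin n → ℝ =>
      (updateKernel X Q v (latentMap X y b u)).real A) (Measure.pi fun _ => unif) := by
    have hl : Measurable (latentMap X y b) := measurable_latentMap.of_uncurry_left
    have hm := ((Kernel.measurable_coe (updateKernel X Q v) hA).comp hl).ennreal_toReal
    refine Integrable.of_bound hm.aestronglyMeasurable 1 (ae_of_all _ fun u => ?_)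
    rw [Real.norm_of_nonneg measureReal_nonneg]
    exact measureReal_le_one
  have hae : ∀ᵐ u ∂Measure.pi fun _ : Fin n => unif, ∀ i, u i ∈ Set.Ioo (0 : ℝ) 1 := by
    refine ae_all_iff.2 fun i => ?_
    have h0 : ∀ᵐ u ∂unif, u ∈ Set.Ioo (0 : ℝ) 1 := ae_restrict_mem measurableSet_Ioo
    exact (measurePreserving_eval (fun _ : Fin n => unif) i).quasiMeasurePreserving.ae h0
  rw [acKernel_real_eq_integral b hA, acKernel_real_eq_integral b' hA,
    ← integral_sub (hint b) (hint b'), ← Real.norm_eq_abs]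
  refine (norm_integral_le_of_norm_le_const (C := ((L * ∑ i, ‖whitenedRow X Q i‖₊ ^ 2 : ℝ≥0) : ℝ) *
    psi X Q b b') ?_).trans_eq (by simp)
  filter_upwards [hae] with u hu
  refine (hL (updateMean X Q v (latentMap X y b u)) (updateMean X Q v (latentMap X y b' u))
    A hA).trans ?_
  push_cast
  rw [mul_assoc]
  gcongr
  rw [psi_eq_norm h, whiten_updateMean_sub h, psi_eq_norm h, Finset.sum_mul]
  refine (norm_sum_le _ _).trans (Finset.sum_le_sum fun i _ => ?_)
  rw [norm_smul, Real.norm_eq_abs]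
  have h1 : |latentMap X y b u i - latentMap X y b' u i| ≤ |linPred X b i - linPred X b' i| :=
    abs_truncQuantile_sub_le _ (hu i) _ _
  have h2 : linPred X b i - linPred X b' i =
      inner ℝ (whitenedRow X Q i) (whiten X Q (b - b')) := by
    rw [inner_whitenedRow, unwhiten_whiten h]
    simp [linPred, Matrix.mulVec_sub]
  rw [h2] at h1
  calc _ ≤ (‖whitenedRow X Q i‖ * ‖whiten X Q (b - b')‖) * ‖whitenedRow X Q i‖ := by
        gcongr
        exact h1.trans (abs_real_inner_le_norm _ _)
    _ = _ := by ring

open Classical in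
/-- Both responses make up at least a fraction `η` at every design point. -/
def IsBalanced (X : Matrix (Fin n) (Fin p) ℝ) (y : Fin n → Bool) (η : ℝ) : Prop :=
  ∀ i b, η * (Finset.univ.filter fun j => X j = X i).card ≤
    (Finset.univ.filter fun j => X j = X i ∧ y j = b).card

lemma IsBalanced.exists_response {η : ℝ} (hη : 0 < η) (hbal : IsBalanced X y η) (i : Fin n)
    (b : Bool) : ∃ j, X j = X i ∧ y j = b := by
  classical
  have hN : 0 < ((Finset.univ.filter fun j => X j = X i).card : ℝ) :=
    Nat.cast_pos.2 (Finset.card_pos.2 ⟨i, by simp⟩)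
  have h := (mul_pos hη hN).trans_le (by convert hbal i b)
  obtain ⟨j, hj⟩ := Finset.card_pos.1 (Nat.cast_pos.1 h)
  exact ⟨j, (Finset.mem_filter.1 hj).2⟩

/-- Properness of the posterior and geometric convergence in both distances for balanced
responses. -/
lemma IsBalanced.rates_le {η ρ : ℝ} (hη : 0 < η) (hη4 : η < 4) (hρ : 0 < ρ) (hρ1 : ρ ≤ 1)
    (hbal : IsBalanced X y η) (hQ : Q.PosSemidef) (h : (precision X Q).PosDef)
    (hσ : (1 - η / 4) ^ 2 + sigmaErr X Q ^ 2 ≤ ρ ^ 2) :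
    PosteriorProper X Q v y ∧ rateW X Q v y ≤ ρ ∧ rateTV X Q v y ≤ ρ := by
  have hboth := hbal.exists_response hη
  have hprop := posteriorProper_of_both (v := v) hQ h hboth
  have := isProbabilityMeasure_posterior hprop
  have hc (b b' : EuclideanSpace ℝ (Fin p)) :
      ∫⁻ ξ, ENNReal.ofReal (psi X Q (acMap X Q v y b ξ) (acMap X Q v y b' ξ)) ^ 2 ∂acNoise n p ≤
        ENNReal.ofReal ρ ^ 2 * ENNReal.ofReal (psi X Q b b') ^ 2 := by
    have h0 : 0 ≤ psi X Q b b' := Real.sqrt_nonneg _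
    refine (lintegral_psi_acMap_sq_le hQ h hη4 hbal b b').trans ?_
    rw [← ENNReal.ofReal_pow hρ.le, ← ENNReal.ofReal_pow h0, ← ENNReal.ofReal_mul (sq_nonneg _)]
    gcongr
  obtain ⟨L, hL⟩ := exists_acKernel_lipschitz (v := v) (y := y) h
  exact ⟨hprop,
    convergenceRate_le hρ.le hρ1 (geometricBound_wasserstein measurable_acMap acKernel_eq_map
      (posterior_bind_acKernel hQ h) (measurable_psi h) hc
      (lintegral_psi_sq_posterior_ne_top hQ h hboth)),
    convergenceRate_le hρ.le hρ1 (geometricBound_tvDist measurable_acMap acKernel_eq_map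
      (posterior_bind_acKernel hQ h) (measurable_psi h) hρ hc
      (lintegral_psi_sq_posterior_ne_top hQ h hboth) hL)⟩

end Lipschitz

/-! ### Balance of the responses with high probability -/

section Concentration

open Classical in
/-- Hoeffding's inequality for the number of responses of a given kind. -/
lemma measure_card_response_lt_le {ι Ω : Type*} [Fintype ι] [MeasurableSpace Ω] {P : Measure Ω}
    [IsProbabilityMeasure P] {y : ι → Ω → Bool} (hym : ∀ i, Measurable (y i))
    (hyi : iIndepFun y P) (b : Bool) {δ : ℝ} (hδ : 0 < δ) (hy : ∀ i, δ ≤ P.real {ω | y i ω = b})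
    (S : Finset ι) (hS : S.Nonempty) :
    P {ω | ((S.filter fun i => y i ω = b).card : ℝ) < δ / 2 * S.card} ≤
      ENNReal.ofReal (Real.exp (-(δ ^ 2 / 2 * S.card))) := by
  have hN : 0 < (S.card : ℝ) := Nat.cast_pos.2 (Finset.card_pos.2 hS)
  -- The sign makes a deficit of responses an upper deviation, which is the tail that Hoeffding's
  -- inequality controls.
  set φ : Bool → ℝ := fun a => if a = b then -1 else 0 with hφ
  set Y : ι → Ω → ℝ := fun i ω => φ (y i ω) with hY
  have hYm (i : ι) : Measurable (Y i) := (measurable_of_finite φ).comp (hym i)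
  have hEY (i : ι) : P[Y i] = -P.real {ω | y i ω = b} := by
    have hms : MeasurableSet {ω | y i ω = b} := hym i (measurableSet_singleton b)
    have e : Y i = fun ω => -({ω | y i ω = b}.indicator 1 ω) := by
      funext ω
      by_cases hb : y i ω = b <;> simp [hY, hφ, Set.indicator, hb]
    rw [e, integral_neg, integral_indicator_one hms]
  have hsub (i : ι) : HasSubgaussianMGF (fun ω => Y i ω - P[Y i]) ((‖(0 : ℝ) - (-1)‖₊ / 2) ^ 2) P :=
    hasSubgaussianMGF_of_mem_Icc (hYm i).aemeasurable (ae_of_all _ fun ω => by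
      by_cases hb : y i ω = b <;> simp [hY, hφ, hb])
  have hind : iIndepFun (fun i ω => Y i ω - P[Y i]) P :=
    hyi.comp (fun i a => φ a - ∫ ω, Y i ω ∂P) fun i => measurable_of_finite _
  have hH := HasSubgaussianMGF.measure_sum_ge_le_of_iIndepFun hind (s := S) (fun i _ => hsub i)
    (ε := δ / 2 * S.card) (by positivity)
  -- Each summand ranges over an interval of length 1 and has variance proxy 1/4. With N = |S| and
  -- deviation δN/2, the exponent is (δN/2)²/(2 · N/4) = δ²N/2.
  have hexp : -(δ / 2 * (S.card : ℝ)) ^ 2 /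
      (2 * ((∑ _i ∈ S, (‖(0 : ℝ) - (-1)‖₊ / 2) ^ 2 : ℝ≥0) : ℝ)) = -(δ ^ 2 / 2 * S.card) := by
    simp only [Finset.sum_const, nsmul_eq_mul]
    push_cast
    simp only [zero_sub, neg_neg, norm_one]
    field_simp
  rw [hexp] at hH
  refine le_trans (measure_mono fun ω hω => ?_)
    ((ENNReal.le_ofReal_iff_toReal_le (measure_ne_top P _) (Real.exp_pos _).le).2 hH)
  change δ / 2 * S.card ≤ ∑ i ∈ S, (Y i ω - P[Y i])
  have hω' : ((S.filter fun i => y i ω = b).card : ℝ) < δ / 2 * S.card := hω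
  have e1 : ∑ i ∈ S, Y i ω = -((S.filter fun i => y i ω = b).card : ℝ) := by
    simp only [hY, hφ]
    rw [← Finset.sum_filter, Finset.sum_const, nsmul_eq_mul, mul_neg_one]
  have e2 : δ * S.card ≤ ∑ i ∈ S, -P[Y i] := by
    calc δ * S.card = ∑ _i ∈ S, δ := by rw [Finset.sum_const, nsmul_eq_mul, mul_comm]
      _ ≤ _ := Finset.sum_le_sum fun i _ => by rw [hEY, neg_neg]; exact hy i
  simp only [Finset.sum_neg_distrib] at e2
  rw [Finset.sum_sub_distrib, e1]
  linarith

/-- With large groups of identical rows, the responses are balanced with high probability. -/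
lemma measure_not_isBalanced_le {n p : ℕ} {X : Matrix (Fin n) (Fin p) ℝ} {Ω : Type*}
    [MeasurableSpace Ω] {P : Measure Ω} [IsProbabilityMeasure P] {y : Fin n → Ω → Bool}
    (hym : ∀ i, Measurable (y i)) (hyi : iIndepFun y P) {δ : ℝ} (hδ : 0 < δ)
    (hy : ∀ i b, δ ≤ P.real {ω | y i ω = b}) {m : ℕ} (hm : ∀ i, m ≤ {j | X j = X i}.ncard) :
    P {ω | ¬ IsBalanced X (fun i => y i ω) (δ / 2)} ≤
      ENNReal.ofReal (2 * (Set.range fun i => X i).ncard * Real.exp (-(δ ^ 2 / 2 * m))) := by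
  classical
  set S : (Fin p → ℝ) → Finset (Fin n) := fun x => Finset.univ.filter fun j => X j = x
  set I : Finset (Fin p → ℝ) := Finset.univ.image fun i => X i
  have hI : I.card = (Set.range fun i => X i).ncard := by
    rw [← Set.ncard_coe_finset]
    congr 1
    ext x; simp [I]
  have hsub : {ω | ¬ IsBalanced X (fun i => y i ω) (δ / 2)} ⊆ ⋃ x ∈ I, ⋃ b : Bool,
      {ω | (((S x).filter fun i => y i ω = b).card : ℝ) < δ / 2 * (S x).card} := by
    intro ω hω
    have hω' : ¬ IsBalanced X (fun i => y i ω) (δ / 2) := hω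
    unfold IsBalanced at hω'
    push Not at hω'
    obtain ⟨i, b, hib⟩ := hω'
    simp only [Set.mem_iUnion]
    refine ⟨X i, Finset.mem_image_of_mem _ (Finset.mem_univ i), b, ?_⟩
    change (((S (X i)).filter fun i => y i ω = b).card : ℝ) < δ / 2 * (S (X i)).card
    simp only [S, Finset.filter_filter]
    convert hib
  have hle (x) (hx : x ∈ I) (b : Bool) :
      P {ω | (((S x).filter fun i => y i ω = b).card : ℝ) < δ / 2 * (S x).card} ≤
        ENNReal.ofReal (Real.exp (-(δ ^ 2 / 2 * m))) := by
    obtain ⟨i, -, rfl⟩ := Finset.mem_image.1 hx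
    have hcard : m ≤ (S (X i)).card := by
      refine (hm i).trans_eq ?_
      rw [← Set.ncard_coe_finset]
      congr 1
      ext j; simp [S]
    refine le_trans ?_ ((measure_card_response_lt_le hym hyi b hδ (fun i => hy i b) (S (X i))
      ⟨i, by simp [S]⟩).trans (ENNReal.ofReal_le_ofReal (Real.exp_le_exp.2 (neg_le_neg ?_))))
    · refine measure_mono fun ω hω => ?_
      convert hω
    · gcongr
  calc P {ω | ¬ IsBalanced X (fun i => y i ω) (δ / 2)}
      ≤ ∑ x ∈ I, ∑ b : Bool,
        P {ω | (((S x).filter fun i => y i ω = b).card : ℝ) < δ / 2 * (S x).card} :=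
        (measure_mono hsub).trans ((measure_biUnion_finset_le _ _).trans
          (Finset.sum_le_sum fun x _ => measure_iUnion_fintype_le _ _))
    _ ≤ ∑ x ∈ I, ∑ b : Bool, ENNReal.ofReal (Real.exp (-(δ ^ 2 / 2 * m))) :=
        Finset.sum_le_sum fun x hx => Finset.sum_le_sum fun b _ => hle x hx b
    _ = _ := by
        rw [← hI, Finset.sum_const, Finset.sum_const, Finset.card_univ, Fintype.card_bool,
          nsmul_eq_mul, nsmul_eq_mul, ENNReal.ofReal_mul (by positivity),
          ENNReal.ofReal_mul (by norm_num), ENNReal.ofReal_natCast]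
        norm_num
        ring

/-- The smallest number of repetitions that `IsRepeatedDesign` guarantees: all rows coincide when
there is a single distinct row. -/
lemma IsRepeatedDesign.le_ncard {n p : ℕ} {X : Matrix (Fin n) (Fin p) ℝ} {q r : ℕ}
    (hX : IsRepeatedDesign X q r) (i : Fin n) :
    (if q = 1 then n else r) ≤ {j | X j = X i}.ncard := by
  split_ifs with hq
  · obtain ⟨x, hx⟩ := Set.ncard_eq_one.1 (hX.2.2.1.trans hq)
    have h (j : Fin n) : X j = x := by
      have : X j ∈ Set.range fun i => X i := ⟨j, rfl⟩
      rwa [hx] at this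
    have : {j | X j = X i} = Set.univ := by
      ext j; simp [h j, h i]
    rw [this, Set.ncard_univ, Nat.card_eq_fintype_card, Fintype.card_fin]
  · exact hX.2.2.2 i

/-- Where q ≥ 2, log q ≥ log 2, so (log q)/r → 0 forces r to be large. Where q = 1 the ratio is 0
and says nothing about r, but then all n rows coincide and n → ∞. Eventually log q is at most half
of the exponent, and the other half still tends to infinity. -/
lemma tendsto_mul_exp_neg_repetitions {n q r : ℕ → ℕ} (hn : Tendsto n atTop atTop)
    (hq : ∀ k, 0 < q k) (hr : ∀ k, 0 < r k)
    (h : Tendsto (fun k => Real.log (q k) / (r k : ℝ)) atTop (𝓝 0)) {c : ℝ} (hc : 0 < c) :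
    Tendsto (fun k => 2 * (q k : ℝ) *
      Real.exp (-(c * ((if q k = 1 then n k else r k : ℕ) : ℝ)))) atTop (𝓝 0) := by
  set m : ℕ → ℕ := fun k => if q k = 1 then n k else r k with hm
  have hlog2 : 0 < Real.log 2 := Real.log_pos one_lt_two
  have hq2 {k : ℕ} (hk : q k ≠ 1) : Real.log 2 ≤ Real.log (q k) := by
    refine Real.log_le_log two_pos ?_
    have : 2 ≤ q k := by have := hq k; omega
    exact_mod_cast this
  have hmt : Tendsto (fun k => (m k : ℝ)) atTop atTop := by
    refine tendsto_atTop.2 fun B => ?_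
    have hB : 0 < Real.log 2 / (|B| + 1) := by positivity
    filter_upwards [(tendsto_natCast_atTop_atTop.comp hn).eventually_ge_atTop B,
      h.eventually (gt_mem_nhds hB)] with k h1 h2
    by_cases hk : q k = 1
    · simpa [hm, hk] using h1
    · simp only [hm, hk, if_false]
      have hrk : 0 < (r k : ℝ) := Nat.cast_pos.2 (hr k)
      rw [div_lt_div_iff₀ hrk (by positivity)] at h2
      have h3 : Real.log 2 * (|B| + 1) < Real.log 2 * r k :=
        (mul_le_mul_of_nonneg_right (hq2 hk) (by positivity)).trans_lt h2
      have := lt_of_mul_lt_mul_left h3 hlog2.le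
      linarith [le_abs_self B]
  have hlog : ∀ᶠ k in atTop, Real.log (q k) ≤ c / 2 * m k := by
    filter_upwards [h.eventually (gt_mem_nhds (half_pos hc))] with k h1
    by_cases hk : q k = 1
    · simp only [hk, Nat.cast_one, Real.log_one]
      positivity
    · simp only [hm, hk, if_false]
      rw [div_lt_iff₀ (Nat.cast_pos.2 (hr k))] at h1
      exact h1.le
  have hlim : Tendsto (fun k => 2 * Real.exp (-(c / 2 * m k))) atTop (𝓝 0) := by
    have := (Real.tendsto_exp_neg_atTop_nhds_zero.comp
      (hmt.const_mul_atTop (half_pos hc))).const_mul 2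
    simpa using this
  refine tendsto_of_tendsto_of_tendsto_of_le_of_le' tendsto_const_nhds hlim
    (Eventually.of_forall fun k => by positivity) ?_
  filter_upwards [hlog] with k hk
  have hqk : 0 < (q k : ℝ) := Nat.cast_pos.2 (hq k)
  rw [mul_assoc]
  refine mul_le_mul_of_nonneg_left ?_ two_pos.le
  nth_rewrite 1 [← Real.exp_log hqk]
  rw [← Real.exp_add]
  refine Real.exp_le_exp.2 ?_
  linarith

end Concentration

end ProbitAC

end

/-! ### The proposition -/

theorem proposition6
    -- sample sizes, dimensions, numbers of distinct rows, minimal numbers of repetitions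
    (n p q r : ℕ → ℕ)
    (hn : Tendsto n atTop atTop) (hp : Tendsto p atTop atTop)
    -- deterministic design matrices, with repeated rows
    (X : ∀ k, Matrix (Fin (n k)) (Fin (p k)) ℝ)
    (hX : ∀ k, ProbitAC.IsRepeatedDesign (X k) (q k) (r k))
    -- prior parameters
    (Q : ∀ k, Matrix (Fin (p k)) (Fin (p k)) ℝ)
    (hQ : ∀ k, (Q k).PosDef ∨ Q k = 0)
    (v : ∀ k, EuclideanSpace ℝ (Fin (p k)))
    -- inverse link function and true regression coefficients
    (G : ℝ → ℝ) (hG : ∀ μ, G μ ∈ Set.Ioo (0 : ℝ) 1)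
    (βs : ∀ k, EuclideanSpace ℝ (Fin (p k)))
    -- independent Bernoulli responses
    {Ω : ℕ → Type*} [∀ k, MeasurableSpace (Ω k)]
    (P : ∀ k, Measure (Ω k)) [∀ k, IsProbabilityMeasure (P k)]
    (y : ∀ k, Fin (n k) → Ω k → Bool)
    (hy_meas : ∀ k i, Measurable (y k i))
    (hy_indep : ∀ k, iIndepFun (y k) (P k))
    (hy_law : ∀ k i, P k {ω | y k i ω = true} =
      ENNReal.ofReal (G (ProbitAC.linPred (X k) (βs k) i)))
    -- `Σ` is non-singular
    (hD1 : ∀ k, IsUnit (ProbitAC.precision (X k) (Q k)).det)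
    -- `σ (2 log p)^{1/2} → 0`
    (hD2 : Tendsto (fun k => ProbitAC.sigmaErr (X k) (Q k) * √(2 * Real.log (p k))) atTop (𝓝 0))
    -- `r ≫ log q`
    (hD3 : Tendsto (fun k => Real.log (q k) / (r k : ℝ)) atTop (𝓝 0))
    -- bounded linear predictors, with `G` bounded away from `0` and `1` on their range
    (ℓ : ℝ) (hℓ : 0 < sInf ((fun μ => min (G μ) (1 - G μ)) '' {μ : ℝ | |μ| < ℓ}))
    (hD4 : ∀ k i, |ProbitAC.linPred (X k) (βs k) i| < ℓ) :
    ∃ ρ : ℝ, ρ < 1 ∧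
      Tendsto (fun k => P k {ω | ¬ ProbitAC.PosteriorProper (X k) (Q k) (v k) fun i => y k i ω})
        atTop (𝓝 0) ∧
      ∀ ε : ℝ, 0 < ε →
        Tendsto (fun k => P k {ω | ρ + ε < ProbitAC.rateW (X k) (Q k) (v k) fun i => y k i ω})
          atTop (𝓝 0) ∧
        Tendsto (fun k => P k {ω | ρ + ε < ProbitAC.rateTV (X k) (Q k) (v k) fun i => y k i ω})
          atTop (𝓝 0) := by
  set δ : ℝ := sInf ((fun μ => min (G μ) (1 - G μ)) '' {μ : ℝ | |μ| < ℓ}) with hδ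
  have hδle (k : ℕ) (i : Fin (n k)) : δ ≤ min (G (ProbitAC.linPred (X k) (βs k) i))
      (1 - G (ProbitAC.linPred (X k) (βs k) i)) := by
    refine csInf_le ⟨0, ?_⟩ ⟨_, hD4 k i, rfl⟩
    rintro _ ⟨μ, -, rfl⟩
    exact le_min (hG μ).1.le (sub_nonneg.2 (hG μ).2.le)
  -- A linear predictor is needed to compare δ with a value of G; a row exists at k = 0 because q 0
  -- > 0.
  have hδ1 : δ ≤ 1 := by
    obtain ⟨_, i, -⟩ : (Set.range fun i => X 0 i).Nonempty :=
      Set.nonempty_of_ncard_ne_zero ((hX 0).2.2.1.trans_ne (hX 0).1.ne')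
    exact (hδle 0 i).trans ((min_le_left _ _).trans (hG _).2.le)
  have hlaw (k : ℕ) (i : Fin (n k)) (b : Bool) : δ ≤ (P k).real {ω | y k i ω = b} := by
    have htrue : (P k).real {ω | y k i ω = true} = G (ProbitAC.linPred (X k) (βs k) i) := by
      rw [Measure.real, hy_law, ENNReal.toReal_ofReal (hG _).1.le]
    cases b with
    | true => exact htrue ▸ (hδle k i).trans (min_le_left _ _)
    | false =>
      have hc : {ω | y k i ω = false} = {ω | y k i ω = true}ᶜ := by
        ext ω; simp
      have hms : MeasurableSet {ω | y k i ω = true} := hy_meas k i (measurableSet_singleton true)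
      rw [hc, probReal_compl_eq_one_sub hms, htrue]
      exact (hδle k i).trans (min_le_right _ _)
  -- Every response has probability at least δ, so a fraction η = δ/2 is typical and the mean
  -- contracts by κ = 1 - η/4. Placing ρ midway between κ and 1 leaves room for σ², which is
  -- eventually below ρ² - κ².
  set κ : ℝ := 1 - δ / 2 / 4 with hκ
  set ρ : ℝ := (1 + κ) / 2 with hρ
  have hκ0 : 0 < κ := by linarith
  have hκ1 : κ < 1 := by linarith
  have hρ0 : 0 < ρ := by linarith
  have hρ1 : ρ < 1 := by linarith
  have hκρ : κ ^ 2 < ρ ^ 2 := by gcongr; linarith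
  have hσ : ∀ᶠ k in atTop, κ ^ 2 + ProbitAC.sigmaErr (X k) (Q k) ^ 2 ≤ ρ ^ 2 := by
    -- As p → ∞ this factor is eventually at least 1, so σ itself tends to 0.
    have hlog : ∀ᶠ k in atTop, (1 : ℝ) ≤ √(2 * Real.log (p k)) := by
      have h1 : Tendsto (fun k => Real.log (p k)) atTop atTop :=
        Real.tendsto_log_atTop.comp (tendsto_natCast_atTop_atTop.comp hp)
      filter_upwards [h1.eventually_ge_atTop 1] with k hk
      exact Real.one_le_sqrt.2 (by linarith)
    have h0 : Tendsto (fun k => ProbitAC.sigmaErr (X k) (Q k)) atTop (𝓝 0) := by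
      refine tendsto_of_tendsto_of_tendsto_of_le_of_le' tendsto_const_nhds hD2
        (Eventually.of_forall fun k => Real.sqrt_nonneg _) ?_
      filter_upwards [hlog] with k hk
      exact le_mul_of_one_le_right (Real.sqrt_nonneg _) hk
    have h2 : Tendsto (fun k => κ ^ 2 + ProbitAC.sigmaErr (X k) (Q k) ^ 2) atTop (𝓝 (κ ^ 2)) := by
      simpa using (h0.pow 2).const_add (κ ^ 2)
    exact (h2.eventually (gt_mem_nhds hκρ)).mono fun k hk => hk.le
  have hbad : Tendsto (fun k => P k {ω | ¬ ProbitAC.IsBalanced (X k) (fun i => y k i ω) (δ / 2)})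
      atTop (𝓝 0) := by
    have hlim := ENNReal.tendsto_ofReal (ProbitAC.tendsto_mul_exp_neg_repetitions hn
      (fun k => (hX k).1) (fun k => (hX k).2.1) hD3 (c := δ ^ 2 / 2) (by positivity))
    rw [ENNReal.ofReal_zero] at hlim
    refine tendsto_of_tendsto_of_tendsto_of_le_of_le tendsto_const_nhds hlim
      (fun k => zero_le) fun k => ?_
    have h := ProbitAC.measure_not_isBalanced_le (hy_meas k) (hy_indep k) hℓ (hlaw k)
      fun i => (hX k).le_ncard i
    rwa [(hX k).2.2.1] at h
  have hrates : ∀ᶠ k in atTop, ∀ ω, ProbitAC.IsBalanced (X k) (fun i => y k i ω) (δ / 2) →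
      ProbitAC.PosteriorProper (X k) (Q k) (v k) (fun i => y k i ω) ∧
      ProbitAC.rateW (X k) (Q k) (v k) (fun i => y k i ω) ≤ ρ ∧
      ProbitAC.rateTV (X k) (Q k) (v k) (fun i => y k i ω) ≤ ρ := by
    filter_upwards [hσ] with k hk ω hω
    have hQk := ProbitAC.posSemidef_of_posDef_or_zero (hQ k)
    exact hω.rates_le (half_pos hℓ) (by linarith) hρ0 hρ1.le hQk
      (ProbitAC.posDef_precision hQk (hD1 k)) hk
  have hzero {s : ∀ k, Set (Ω k)} (hs : ∀ᶠ k in atTop, s k ⊆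
      {ω | ¬ ProbitAC.IsBalanced (X k) (fun i => y k i ω) (δ / 2)}) :
      Tendsto (fun k => P k (s k)) atTop (𝓝 0) :=
    tendsto_of_tendsto_of_tendsto_of_le_of_le' tendsto_const_nhds hbad
      (Eventually.of_forall fun k => zero_le) (hs.mono fun k hk => measure_mono hk)
  refine ⟨ρ, hρ1, hzero ?_, fun ε hε => ⟨hzero ?_, hzero ?_⟩⟩
  · exact hrates.mono fun k hk ω hω hb => hω (hk ω hb).1
  · filter_upwards [hrates] with k hk ω hω hb
    have hω' : ρ + ε < ProbitAC.rateW (X k) (Q k) (v k) fun i => y k i ω := hω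
    linarith [(hk ω hb).2.1]
  · filter_upwards [hrates] with k hk ω hω hb
    have hω' : ρ + ε < ProbitAC.rateTV (X k) (Q k) (v k) fun i => y k i ω := hω
    linarith [(hk ω hb).2.2]
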